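/- Let $\mathcal X,\mathcal Y_1,\mathcal Y_2,\hat{\mathcal X}_1,\hat{\mathcal X}_2$ be finite sets, let $P$ be a probability distribution on $\mathcal X\times\mathcal Y_1\times\mathcal Y_2$, and let $(X_i,Y_{1,i},Y_{2,i})_{i\ge 1}$ be independent copies of $(X,Y_1,Y_2)\sim P$. Suppose that $X\leftrightarrow Y_1\leftrightarrow Y_2$ is a Markov string. Let $d_j:\mathcal X\times\hat{\mathcal X}_j\to[0,\infty)$, $j=1,2$, be distortion measures, extended to vectors by $d_j(x^n,\hat x^n)=\frac1n\sum_{i=1}^n d_j(x_i,\hat x_i)$, and let $D_1,D_2\in\mathbb R$. Logarithms and mutual informations are to base 2. An $(n,M_1,M_2,D_1,D_2)$ code consists of maps $\phi_1:\mathcal X^n\to\{1,\dots,M_1\}$, $\phi_2:\mathcal X^n\to\{1,\dots,M_2\}$, $\psi_1:\{1,\dots,M_1\}\times\mathcal Y_1^n\to\hat{\mathcal X}_1^n$ and $\psi_2:\{1,\dots,M_1\}\times\{1,\dots,M_2\}\times\mathcal Y_2^n\to\hat{\mathcal X}_2^n$ with $$\mathbb E\,d_1(X^n,\psi_1(\phi_1(X^n),Y_1^n))\le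 D_1,\qquad \mathbb E\,d_2(X^n,\psi_2(\phi_1(X^n),\phi_2(X^n),Y_2^n))\le D_2 .$$ Let $\mathcal R(D_1,D_2)$ be the set of all pairs $(R_1,R_2)\in\mathbb R^2$ such that for every $\epsilon>0$ and all sufficiently large $n$ there is an $(n,M_1,M_2,D_1+\epsilon,D_2+\epsilon)$ code, for some $M_1,M_2$, with $R_j+\epsilon\ge\frac1n\log M_j$ for $j=1,2$. Let $\mathcal R_{in}(D_1,D_2)$ be the set of all pairs $(R_1,R_2)$ with $R_1,R_2\ge 0$ for which there are random variables $(W_1,W_2,V)$ in finite alphabets $\mathcal W_1,\mathcal W_2,\mathcal V$, jointly distributed with $(X,Y_1,Y_2)$, such that 1. $(W_1,W_2,V)\leftrightarrow X\leftrightarrow Y_1\leftrightarrow Y_2$ is a Markov string; 2. there are maps $f_j:\mathcal W_j\times\mathcal Y_j\to\hat{\mathcal X}_j$ with $\mathbb E\,d_j(X,f_j(W_j,Y_j))\le D_j$ for $j=1,2$; 3. $R_1\ge I(X;V,W_1|Y_1)$ and $R_1+R_2\ge I(X;V,W_2|Y_2)+I(X;W_1|Y_1,V)$; 4. $W_1\leftrightarrow(X,V)\leftrightarrow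 W_2$ is a Markov string; 5. $|\mathcal V|\le|\mathcal X|+3$, and $|\mathcal W_j|\le|\mathcal X|(|\mathcal X|+3)+1$ for $j=1,2$. Then $\mathcal R_{in}(D_1,D_2)\subseteq\mathcal R(D_1,D_2)$. -/

import Mathlib

noncomputable section

namespace SIScalable

/-! ### Finite probability: laws, Markov strings, conditional mutual information

A probability mass function on a finite set `Ω` is a member `p` of `stdSimplex ℝ Ω`; a random
variable is a function on `Ω`. -/

section Prob

variable {Ω α β γ δ : Type*} [Fintype Ω]

open Classical in
/-- The probability `p(A = a)`. -/
def law (p : Ω → ℝ) (A : Ω → α) (a : α) : ℝ := ∑ ω : Ω, if A ω = a then p ω else 0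

/-- The expectation of a real random variable. -/
def expect (p : Ω → ℝ) (f : Ω → ℝ) : ℝ := ∑ ω : Ω, p ω * f ω

/-- The Markov string `A ↔ B ↔ C`: `A` and `C` are conditionally independent given `B`, that is
`p(a,b,c) p(b) = p(a,b) p(b,c)`. -/
def Markov (p : Ω → ℝ) (A : Ω → α) (B : Ω → β) (C : Ω → γ) : Prop :=
  ∀ a b c, law p (fun ω => (A ω, B ω, C ω)) (a, b, c) * law p B b =
    law p (fun ω => (A ω, B ω)) (a, b) * law p (fun ω => (B ω, C ω)) (b, c)

/-- The Markov string `A ↔ B ↔ C ↔ D`. -/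
def Markov4 (p : Ω → ℝ) (A : Ω → α) (B : Ω → β) (C : Ω → γ) (D : Ω → δ) : Prop :=
  Markov p A B (fun ω => (C ω, D ω)) ∧ Markov p (fun ω => (A ω, B ω)) C D

/-- The conditional mutual information `I(A;B|C)` in bits:
`∑ p(a,b,c) log₂ (p(a,b,c) p(c) / (p(a,c) p(b,c)))`. Terms with `p(a,b,c) = 0` vanish. -/
def condMI [Fintype α] [Fintype β] [Fintype γ]
    (p : Ω → ℝ) (A : Ω → α) (B : Ω → β) (C : Ω → γ) : ℝ :=
  ∑ a : α, ∑ b : β, ∑ c : γ, law p (fun ω => (A ω, B ω, C ω)) (a, b, c) *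
    Real.logb 2 ((law p (fun ω => (A ω, B ω, C ω)) (a, b, c) * law p C c) /
      (law p (fun ω => (A ω, C ω)) (a, c) * law p (fun ω => (B ω, C ω)) (b, c)))

end Prob

/-! ### Codes and achievable rates -/

section Codes

variable {X Y₁ Y₂ X₁ X₂ : Type*}

/-- The law of `n` independent copies of a random variable with probability mass function `P`. -/
def iid {S : Type*} (P : S → ℝ) (n : ℕ) : (Fin n → S) → ℝ := fun s => ∏ i, P (s i)

/-- The extension of a distortion measure to vectors of length `n`. -/
def avgDist {Z : Type*} (d : X → Z → ℝ) {n : ℕ} (x : Fin n → X) (z : Fin n → Z) : ℝ :=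
  (1 / (n : ℝ)) * ∑ i, d (x i) (z i)

/-- Two encoding and two decoding functions of block length `n`. The first decoder sees the first
index and its side information, the second one sees both indices and its side information. -/
structure Code (X Y₁ Y₂ X₁ X₂ : Type*) (n M₁ M₂ : ℕ) where
  enc₁ : (Fin n → X) → Fin M₁
  enc₂ : (Fin n → X) → Fin M₂
  dec₁ : Fin M₁ → (Fin n → Y₁) → (Fin n → X₁)
  dec₂ : Fin M₁ → Fin M₂ → (Fin n → Y₂) → (Fin n → X₂)

variable [Fintype X] [Fintype Y₁] [Fintype Y₂]

/-- The code meets the expected distortions `D₁` and `D₂`, that is, it is an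
`(n, M₁, M₂, D₁, D₂)` code for the memoryless source with generic law `P`. -/
def Code.MeetsDistortion {n M₁ M₂ : ℕ} (c : Code X Y₁ Y₂ X₁ X₂ n M₁ M₂)
    (P : X × Y₁ × Y₂ → ℝ) (d₁ : X → X₁ → ℝ) (d₂ : X → X₂ → ℝ) (D₁ D₂ : ℝ) : Prop :=
  expect (iid P n) (fun s =>
    let x : Fin n → X := fun i => (s i).1
    let y₁ : Fin n → Y₁ := fun i => (s i).2.1
    avgDist d₁ x (c.dec₁ (c.enc₁ x) y₁)) ≤ D₁ ∧
  expect (iid P n) (fun s =>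
    let x : Fin n → X := fun i => (s i).1
    let y₂ : Fin n → Y₂ := fun i => (s i).2.2
    avgDist d₂ x (c.dec₂ (c.enc₁ x) (c.enc₂ x) y₂)) ≤ D₂

/-- The region `R(D₁, D₂)` of all `(D₁, D₂)`-achievable rate pairs. -/
def achievableRegion (P : X × Y₁ × Y₂ → ℝ) (d₁ : X → X₁ → ℝ) (d₂ : X → X₂ → ℝ)
    (D₁ D₂ : ℝ) : Set (ℝ × ℝ) :=
  {R | ∀ ε : ℝ, 0 < ε → ∃ N : ℕ, ∀ n : ℕ, N ≤ n →
    ∃ (M₁ M₂ : ℕ) (c : Code X Y₁ Y₂ X₁ X₂ n M₁ M₂),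
      c.MeetsDistortion P d₁ d₂ (D₁ + ε) (D₂ + ε) ∧
      (1 / (n : ℝ)) * Real.logb 2 M₁ ≤ R.1 + ε ∧
      (1 / (n : ℝ)) * Real.logb 2 M₂ ≤ R.2 + ε}

/-- Conditions on random variables `(W₁, W₂, V)`, jointly distributed with `(X, Y₁, Y₂)` according
to `q`, which place the rate pair `(R₁, R₂)` in the inner region. -/
structure InnerConditions {W₁ W₂ V : Type*} [Fintype W₁] [Fintype W₂] [Fintype V]
    (P : X × Y₁ × Y₂ → ℝ) (d₁ : X → X₁ → ℝ) (d₂ : X → X₂ → ℝ) (D₁ D₂ R₁ R₂ : ℝ)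
    (q : (W₁ × W₂ × V) × (X × Y₁ × Y₂) → ℝ) : Prop where
  pmf : q ∈ stdSimplex ℝ ((W₁ × W₂ × V) × (X × Y₁ × Y₂))
  /-- `(X, Y₁, Y₂)` has the generic law of the source. -/
  marginal : ∀ s, law q (fun ω => ω.2) s = P s
  /-- `(W₁, W₂, V) ↔ X ↔ Y₁ ↔ Y₂`. -/
  markov : Markov4 q (fun ω => ω.1) (fun ω => ω.2.1) (fun ω => ω.2.2.1) (fun ω => ω.2.2.2)
  dist₁ : ∃ f₁ : W₁ → Y₁ → X₁, expect q (fun ω => d₁ ω.2.1 (f₁ ω.1.1 ω.2.2.1)) ≤ D₁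
  dist₂ : ∃ f₂ : W₂ → Y₂ → X₂, expect q (fun ω => d₂ ω.2.1 (f₂ ω.1.2.1 ω.2.2.2)) ≤ D₂
  nonneg₁ : 0 ≤ R₁
  nonneg₂ : 0 ≤ R₂
  /-- `R₁ ≥ I(X; V, W₁ | Y₁)`. -/
  rate₁ : condMI q (fun ω => ω.2.1) (fun ω => (ω.1.2.2, ω.1.1)) (fun ω => ω.2.2.1) ≤ R₁
  /-- `R₁ + R₂ ≥ I(X; V, W₂ | Y₂) + I(X; W₁ | Y₁, V)`. -/
  sumRate :
    condMI q (fun ω => ω.2.1) (fun ω => (ω.1.2.2, ω.1.2.1)) (fun ω => ω.2.2.2) +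
      condMI q (fun ω => ω.2.1) (fun ω => ω.1.1) (fun ω => (ω.2.2.1, ω.1.2.2)) ≤ R₁ + R₂
  /-- `W₁ ↔ (X, V) ↔ W₂`. -/
  markovW : Markov q (fun ω => ω.1.1) (fun ω => (ω.2.1, ω.1.2.2)) (fun ω => ω.1.2.1)
  card_V : Fintype.card V ≤ Fintype.card X + 3
  card_W₁ : Fintype.card W₁ ≤ Fintype.card X * (Fintype.card X + 3) + 1
  card_W₂ : Fintype.card W₂ ≤ Fintype.card X * (Fintype.card X + 3) + 1

/-- The inner region `R_in(D₁, D₂)`. -/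
def innerRegion (P : X × Y₁ × Y₂ → ℝ) (d₁ : X → X₁ → ℝ) (d₂ : X → X₂ → ℝ)
    (D₁ D₂ : ℝ) : Set (ℝ × ℝ) :=
  {R | ∃ (W₁ W₂ V : Type) (_ : Fintype W₁) (_ : Fintype W₂) (_ : Fintype V)
    (q : (W₁ × W₂ × V) × (X × Y₁ × Y₂) → ℝ),
    InnerConditions P d₁ d₂ D₁ D₂ R.1 R.2 q}

end Codes

end SIScalable

end

/-! The proof is random coding for a fixed test channel, with random binning doing both halves of
the work. Let a word `u` (a block of `V`, `W₁` or `W₂`) be chosen by an encoder that knows `s` and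
recovered by a decoder that knows `t`. A uniformly random map `φ` thins the set of all words to the
codebook `{u | φ u = b₀}` of density `1/K`, and a second random map gives every word one of `M`
indices. Typical words have conditional probability about `2^(-nH(U|s))`, so for `K` slightly below
`2^(nH(U|s))` the weight caught by the codebook concentrates (`expect_ind_thinned_weight_lt`). About
`2^(nH(U|t))` words are likely given `t`, so for `K * M` slightly above that number few rivals share
both codebook and index (`expect_decErr_le`). The price is `H(U|t) - H(U|s)` bits per letter.

The encoder does not test joint typicality. It picks the codeword of least cost, where the cost
counts the later failures. A minimum is at most an average, so the cost is at most twice the mean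
cost under the test channel (`exists_covering`). All failure probabilities are thus computed for
independent copies of the test channel, which makes a Markov lemma superfluous.

The refinement codebooks are fixed first, and their failures become a cost of the choice of `v`
(`exists_oneShot_code`). The index of `v` has two parts: rate `H(V|Y₁) - H(V|X)` serves decoder 1,
and a further `H(V|Y₂) - H(V|Y₁)`, nonnegative since `V ↔ Y₁ ↔ Y₂`, serves decoder 2. Given `v`, the
word `w_j` costs `H(W_j|Y_j,V) - H(W_j|X,V)`. The Markov strings turn the sums of these exponents
into the mutual informations of the two rate constraints. Whatever of the private indices of decoder
2 exceeds `R₂` travels in the first message, which decoder 2 also sees (`exists_code_of_splitting`).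
-/

namespace SIScalable

open Filter
open scoped BigOperators

/-! ### Indicators -/

open Classical in
/-- The real indicator of a proposition. -/
noncomputable def ind (p : Prop) : ℝ := if p then 1 else 0

theorem ind_pos {p : Prop} (h : p) : ind p = 1 := if_pos h

theorem ind_neg {p : Prop} (h : ¬p) : ind p = 0 := if_neg h

theorem ind_nonneg (p : Prop) : 0 ≤ ind p := by
  unfold ind; split_ifs <;> norm_num

theorem ind_le_one (p : Prop) : ind p ≤ 1 := by
  unfold ind; split_ifs <;> norm_num

theorem ind_mono {p q : Prop} (h : p → q) : ind p ≤ ind q := by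
  by_cases hp : p
  · rw [ind_pos hp, ind_pos (h hp)]
  · rw [ind_neg hp]; exact ind_nonneg q

theorem ind_or_le (p q : Prop) : ind (p ∨ q) ≤ ind p + ind q := by
  unfold ind; split_ifs <;> simp_all

theorem ind_and (p q : Prop) : ind (p ∧ q) = ind p * ind q := by
  unfold ind; split_ifs <;> simp_all

theorem ind_not (p : Prop) : ind (¬p) = 1 - ind p := by
  unfold ind; split_ifs <;> simp_all

theorem ind_exists_le {ι : Type*} (s : Finset ι) (p : ι → Prop) :
    ind (∃ i ∈ s, p i) ≤ ∑ i ∈ s, ind (p i) := by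
  by_cases h : ∃ i ∈ s, p i
  · obtain ⟨i, hi, hp⟩ := h
    rw [ind_pos ⟨i, hi, hp⟩, ← ind_pos hp]
    exact Finset.single_le_sum (fun j _ => ind_nonneg (p j)) hi
  · rw [ind_neg h]; exact Finset.sum_nonneg fun j _ => ind_nonneg (p j)

/-! ### Uniformly random functions -/

section Hash

variable {U B : Type*} [Fintype U] [DecidableEq U] [Fintype B]

/-- A uniformly random function has independent uniform values. The facts on random maps used below
are specialisations of this product formula. -/
theorem expect_fun_prod (h : U → B → ℝ) :
    (𝔼 φ : U → B, ∏ u, h u (φ u)) = ∏ u, 𝔼 b, h u b := by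
  simp only [Fintype.expect_eq_sum_div_card, Finset.prod_div_distrib, Fintype.prod_sum,
    Fintype.card_fun, Finset.prod_const, Finset.card_univ, Nat.cast_pow]

theorem expect_fun_eval [Nonempty B] (u : U) (F : B → ℝ) : (𝔼 φ : U → B, F (φ u)) = 𝔼 b, F b := by
  have h := expect_fun_prod (U := U) (B := B) (fun v b => if v = u then F b else 1)
  have e : ∀ φ : U → B, (∏ v, if v = u then F (φ v) else 1) = F (φ u) := by
    intro φ; simp
  simp only [e] at h
  rw [h, Finset.prod_eq_single u]
  · simp
  · intro v _ hv; simp [hv]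
  · simp

/-- Pairwise independence: together with the uniform marginals it is all that the second moment and
the union bounds need. -/
theorem expect_fun_eval₂ [Nonempty B] {u u' : U} (hu : u ≠ u') (F G : B → ℝ) :
    (𝔼 φ : U → B, F (φ u) * G (φ u')) = (𝔼 b, F b) * 𝔼 b, G b := by
  have h := expect_fun_prod (U := U) (B := B)
    (fun v b => if v = u then F b else if v = u' then G b else 1)
  have e : ∀ f g : U → ℝ, (∏ v, if v = u then f v else if v = u' then g v else 1)
      = f u * g u' := by
    intro f g
    rw [← Finset.mul_prod_erase _ _ (Finset.mem_univ u), if_pos rfl]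
    congr 1
    rw [Finset.prod_eq_single u']
    · simp [hu.symm]
    · intro v hv hv'
      simp [hv', Finset.ne_of_mem_erase hv]
    · intro h'; simp [hu.symm] at h'
  simp only [e (fun u => F _)] at h
  have e' : (∏ v, 𝔼 b, if v = u then F b else if v = u' then G b else 1)
      = (𝔼 b, F b) * 𝔼 b, G b := by
    rw [← e (fun _ => 𝔼 b, F b) (fun _ => 𝔼 b, G b)]
    refine Finset.prod_congr rfl fun v _ => ?_
    split_ifs <;> simp
  rw [← e', ← h]

theorem expect_ind_eq (b₀ : B) : (𝔼 b : B, ind (b = b₀)) = 1 / Fintype.card B := by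
  classical
  rw [Fintype.expect_eq_sum_div_card]
  simp [ind]

/-- Each of the `|B|` possible common values has probability `1/|B|²`. -/
theorem expect_fun_collide [Nonempty B] {u u' : U} (hu : u ≠ u') :
    (𝔼 φ : U → B, ind (φ u' = φ u)) = 1 / Fintype.card B := by
  classical
  have e : ∀ φ : U → B, ind (φ u' = φ u) = ∑ b, ind (φ u = b) * ind (φ u' = b) := by
    intro φ
    simp [ind, eq_comm]
  simp only [e]
  rw [Finset.expect_sum_comm]
  have : ∀ b : B, (𝔼 φ : U → B, ind (φ u = b) * ind (φ u' = b))
      = (1 / Fintype.card B) * (1 / Fintype.card B) := by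
    intro b
    rw [expect_fun_eval₂ hu (fun c => ind (c = b)) (fun c => ind (c = b)), expect_ind_eq]
  simp only [this, Finset.sum_const, Finset.card_univ, nsmul_eq_mul]
  field_simp

/-! ### Covering by a random subset -/

/-- The second moment of the normalised weight that a random subset of density `1/K` receives. -/
theorem expect_sq_thinned_weight_le [Nonempty B] (s : Finset U) (k : U → ℝ) (hk : ∀ u, 0 ≤ k u)
    (hk1 : ∑ u, k u ≤ 1) {m : ℝ} (hm : ∀ u ∈ s, k u ≤ m) (hm0 : 0 ≤ m) (b₀ : B) :
    (𝔼 φ : U → B, (∑ u ∈ s, k u * ((Fintype.card B : ℝ) * ind (φ u = b₀) - 1)) ^ 2)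
      ≤ ((Fintype.card B : ℝ) - 1) * m := by
  classical
  set K : ℝ := (Fintype.card B : ℝ) with hK
  have hK1 : 1 ≤ K := by
    rw [hK]; exact_mod_cast Fintype.card_pos
  have hK0 : K ≠ 0 := by positivity
  have mean : (𝔼 b : B, (K * ind (b = b₀) - 1)) = 0 := by
    rw [Finset.expect_sub_distrib, ← Finset.mul_expect, expect_ind_eq, ← hK]
    simp [hK0]
  have sq : (𝔼 b : B, (K * ind (b = b₀) - 1) * (K * ind (b = b₀) - 1)) = K - 1 := by
    have : ∀ b : B, (K * ind (b = b₀) - 1) * (K * ind (b = b₀) - 1)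
        = (K * K - 2 * K) * ind (b = b₀) + 1 := by
      intro b; unfold ind; split_ifs <;> ring
    simp only [this]
    rw [Finset.expect_add_distrib, ← Finset.mul_expect, expect_ind_eq, ← hK,
      Fintype.expect_const]
    field_simp; ring
  have pair : ∀ u u' : U, (𝔼 φ : U → B, (K * ind (φ u = b₀) - 1) * (K * ind (φ u' = b₀) - 1))
      = if u = u' then K - 1 else 0 := by
    intro u u'
    split_ifs with h
    · subst h
      rw [expect_fun_eval u (fun b => (K * ind (b = b₀) - 1) * (K * ind (b = b₀) - 1)), sq]
    · rw [expect_fun_eval₂ h (fun b => K * ind (b = b₀) - 1) (fun b => K * ind (b = b₀) - 1),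
        mean, zero_mul]
  calc (𝔼 φ : U → B, (∑ u ∈ s, k u * (K * ind (φ u = b₀) - 1)) ^ 2)
      = 𝔼 φ : U → B, ∑ u ∈ s, ∑ u' ∈ s,
          k u * k u' * ((K * ind (φ u = b₀) - 1) * (K * ind (φ u' = b₀) - 1)) := by
        refine Finset.expect_congr rfl fun φ _ => ?_
        rw [_root_.sq, Finset.sum_mul_sum]
        refine Finset.sum_congr rfl fun u _ => Finset.sum_congr rfl fun u' _ => by ring
    _ = ∑ u ∈ s, ∑ u' ∈ s, k u * k u' * (if u = u' then K - 1 else 0) := by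
        rw [Finset.expect_sum_comm]
        refine Finset.sum_congr rfl fun u _ => ?_
        rw [Finset.expect_sum_comm]
        refine Finset.sum_congr rfl fun u' _ => ?_
        rw [← Finset.mul_expect, pair]
    _ = ∑ u ∈ s, k u * k u * (K - 1) := by
        refine Finset.sum_congr rfl fun u hu => ?_
        simp [hu]
    _ ≤ ∑ u ∈ s, k u * (m * (K - 1)) := by
        refine Finset.sum_le_sum fun u hu => ?_
        rw [mul_assoc]
        exact mul_le_mul_of_nonneg_left
          (mul_le_mul_of_nonneg_right (hm u hu) (by linarith)) (hk u)
    _ = (∑ u ∈ s, k u) * (m * (K - 1)) := by rw [Finset.sum_mul]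
    _ ≤ 1 * (m * (K - 1)) := by
        refine mul_le_mul_of_nonneg_right (le_trans ?_ hk1)
          (mul_nonneg hm0 (by linarith))
        exact Finset.sum_le_sum_of_subset_of_nonneg (Finset.subset_univ s) fun u _ _ => hk u
    _ = (K - 1) * m := by ring

/-- A random subset of density `1/K` is unlikely to receive less than half its expected weight. -/
theorem expect_ind_thinned_weight_lt [Nonempty B] (s : Finset U) (k : U → ℝ) (hk : ∀ u, 0 ≤ k u)
    (hk1 : ∑ u, k u ≤ 1) {m : ℝ} (hm : ∀ u ∈ s, k u ≤ m) (hm0 : 0 ≤ m) (b₀ : B) :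
    (𝔼 φ : U → B, ind ((Fintype.card B : ℝ) * ∑ u ∈ s, k u * ind (φ u = b₀) < 1 / 2))
      ≤ 16 * (((Fintype.card B : ℝ) - 1) * m) + 4 * (1 - ∑ u ∈ s, k u) := by
  set K : ℝ := (Fintype.card B : ℝ) with hK
  have hK1 : 1 ≤ K := by
    rw [hK]; exact_mod_cast Fintype.card_pos
  have hs1 : ∑ u ∈ s, k u ≤ 1 := le_trans
    (Finset.sum_le_sum_of_subset_of_nonneg (Finset.subset_univ s) fun u _ _ => hk u) hk1
  have h0 : 0 ≤ (K - 1) * m := mul_nonneg (by linarith) hm0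
  -- If the good words weigh at most `3/4`, the second term of the bound is already at least 1.
  -- Otherwise a caught weight below `1/2` deviates from its mean by more than `1/4`, and
  -- Chebyshev's inequality gives the factor 16.
  by_cases hG : 1 / 4 ≤ 1 - ∑ u ∈ s, k u
  · refine (Finset.expect_le Finset.univ_nonempty fun φ _ => ind_le_one _).trans ?_
    linarith
  · push Not at hG
    have key := expect_sq_thinned_weight_le s k hk hk1 hm hm0 b₀
    rw [← hK] at key
    have : (𝔼 φ : U → B, ind (K * ∑ u ∈ s, k u * ind (φ u = b₀) < 1 / 2))
        ≤ 𝔼 φ : U → B, 16 * (∑ u ∈ s, k u * (K * ind (φ u = b₀) - 1)) ^ 2 := by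
      refine Finset.expect_le_expect fun φ _ => ?_
      by_cases h : K * ∑ u ∈ s, k u * ind (φ u = b₀) < 1 / 2
      · rw [ind_pos h]
        have e : ∑ u ∈ s, k u * (K * ind (φ u = b₀) - 1)
            = K * ∑ u ∈ s, k u * ind (φ u = b₀) - ∑ u ∈ s, k u := by
          rw [Finset.mul_sum, ← Finset.sum_sub_distrib]
          exact Finset.sum_congr rfl fun u _ => by ring
        rw [e]
        nlinarith
      · rw [ind_neg h]; positivity
    rw [← Finset.mul_expect] at this
    linarith

end Hash

/-- Covering: with a random codebook `{u | φ u = b₀}` of density `1/K`, some choice of a codeword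
for every source value `s` costs at most twice the cost of a codeword drawn from `k s`, up to the
probability that the codebook misses the good words. -/
theorem exists_covering {S U B Ψ : Type*} [Fintype S] [Fintype U] [DecidableEq U] [Nonempty U] [Fintype B]
    [Nonempty B] [Fintype Ψ] [Nonempty Ψ] (b₀ : B) (k : S → U → ℝ) (hk : ∀ s u, 0 ≤ k s u)
    (hk1 : ∀ s, ∑ u, k s u ≤ 1) (good : S → Finset U) {m : ℝ}
    (hm : ∀ s, ∀ u ∈ good s, k s u ≤ m) (hm0 : 0 ≤ m) (a : S → ℝ)
    (c : (U → B) → Ψ → S → U → ℝ) (hc0 : ∀ φ ψ s u, 0 ≤ c φ ψ s u)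
    (hca : ∀ φ ψ s u, c φ ψ s u ≤ a s) :
    ∃ φ ψ, ∃ g : S → U, ∑ s, c φ ψ s (g s) ≤
      2 * ∑ s, ∑ u, k s u *
        (𝔼 ψ, 𝔼 φ : U → B, (Fintype.card B : ℝ) * ind (φ u = b₀) * c φ ψ s u) +
      ∑ s, a s * (16 * (((Fintype.card B : ℝ) - 1) * m) + 4 * (1 - ∑ u ∈ good s, k s u)) := by
  classical
  set K : ℝ := (Fintype.card B : ℝ) with hK
  have hK1 : 1 ≤ K := by
    rw [hK]; exact_mod_cast Fintype.card_pos
  have hK0 : (0 : ℝ) < K := by linarith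
  have ha : ∀ s, 0 ≤ a s := fun s =>
    (hc0 (fun _ => b₀) (Classical.arbitrary Ψ) s (Classical.arbitrary U)).trans
      (hca _ _ s _)
  have choice : ∀ φ ψ s, ∃ u, c φ ψ s u ≤
      2 * ∑ u, k s u * (K * ind (φ u = b₀) * c φ ψ s u) +
        a s * ind (K * ∑ u ∈ good s, k s u * ind (φ u = b₀) < 1 / 2) := by
    intro φ ψ s
    have hsum0 : 0 ≤ ∑ u, k s u * (K * ind (φ u = b₀) * c φ ψ s u) :=
      Finset.sum_nonneg fun u _ => mul_nonneg (hk s u)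
        (mul_nonneg (mul_nonneg hK0.le (ind_nonneg _)) (hc0 _ _ _ _))
    by_cases hZ : K * ∑ u ∈ good s, k s u * ind (φ u = b₀) < 1 / 2
    · refine ⟨Classical.arbitrary U, ?_⟩
      rw [ind_pos hZ]
      linarith [hca φ ψ s (Classical.arbitrary U)]
    · rw [ind_neg hZ]
      push Not at hZ
      -- An empty codebook would catch weight 0, less than `1/2`.
      have hne : (Finset.univ.filter fun u => φ u = b₀).Nonempty := by
        by_contra h
        rw [Finset.not_nonempty_iff_eq_empty, Finset.filter_eq_empty_iff] at h
        have : ∑ u ∈ good s, k s u * ind (φ u = b₀) = 0 :=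
          Finset.sum_eq_zero fun u _ => by rw [ind_neg (h (Finset.mem_univ u)), mul_zero]
        rw [this] at hZ
        norm_num at hZ
      -- The cheapest codeword costs no more than the `k s`-weighted average over the good
      -- codewords. Their normalised weight is at least `1/2`, hence the factor 2.
      obtain ⟨u, hu, hmin⟩ := Finset.exists_min_image _ (fun u => c φ ψ s u) hne
      refine ⟨u, ?_⟩
      have h1 : c φ ψ s u * (K * ∑ u ∈ good s, k s u * ind (φ u = b₀))
          ≤ ∑ u, k s u * (K * ind (φ u = b₀) * c φ ψ s u) := by
        calc c φ ψ s u * (K * ∑ u ∈ good s, k s u * ind (φ u = b₀))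
            = ∑ v ∈ good s, k s v * (K * ind (φ v = b₀) * c φ ψ s u) := by
              rw [Finset.mul_sum, Finset.mul_sum]
              exact Finset.sum_congr rfl fun v _ => by ring
          _ ≤ ∑ v ∈ good s, k s v * (K * ind (φ v = b₀) * c φ ψ s v) := by
              refine Finset.sum_le_sum fun v _ => mul_le_mul_of_nonneg_left ?_ (hk s v)
              by_cases hv : φ v = b₀
              · exact mul_le_mul_of_nonneg_left (hmin v (by simp [hv]))
                  (mul_nonneg hK0.le (ind_nonneg _))
              · simp [ind_neg hv]
          _ ≤ _ := Finset.sum_le_sum_of_subset_of_nonneg (Finset.subset_univ _)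
              fun v _ _ => mul_nonneg (hk s v)
                (mul_nonneg (mul_nonneg hK0.le (ind_nonneg _)) (hc0 _ _ _ _))
      have h2 := mul_le_mul_of_nonneg_left hZ (hc0 φ ψ s u)
      linarith
  choose g hg using choice
  set R : ℝ := 2 * ∑ s, ∑ u, k s u *
        (𝔼 ψ, 𝔼 φ : U → B, K * ind (φ u = b₀) * c φ ψ s u) +
      ∑ s, a s * (16 * ((K - 1) * m) + 4 * (1 - ∑ u ∈ good s, k s u)) with hR
  have avg : (𝔼 ψ, 𝔼 φ : U → B, ∑ s, c φ ψ s (g φ ψ s)) ≤ R := by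
    calc (𝔼 ψ, 𝔼 φ : U → B, ∑ s, c φ ψ s (g φ ψ s))
        ≤ 𝔼 ψ, 𝔼 φ : U → B, ∑ s, (2 * ∑ u, k s u * (K * ind (φ u = b₀) * c φ ψ s u) +
          a s * ind (K * ∑ u ∈ good s, k s u * ind (φ u = b₀) < 1 / 2)) :=
          Finset.expect_le_expect fun ψ _ => Finset.expect_le_expect fun φ _ =>
            Finset.sum_le_sum fun s _ => hg φ ψ s
      _ = 2 * ∑ s, ∑ u, k s u * (𝔼 ψ, 𝔼 φ : U → B, K * ind (φ u = b₀) * c φ ψ s u) +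
          ∑ s, a s * (𝔼 φ : U → B,
            ind (K * ∑ u ∈ good s, k s u * ind (φ u = b₀) < 1 / 2)) := by
          simp only [Finset.expect_sum_comm, Finset.expect_add_distrib, ← Finset.mul_expect,
            Fintype.expect_const, Finset.sum_add_distrib, ← Finset.mul_sum]
      _ ≤ R := by
          rw [hR]
          gcongr with s _
          · exact ha s
          · exact expect_ind_thinned_weight_lt (good s) (k s) (hk s) (hk1 s) (hm s) hm0 b₀
  -- Derandomisation: some realisation of both maps is at least as good as the average.
  obtain ⟨ψ, _, hψ⟩ := Finset.exists_le_of_expect_le Finset.univ_nonempty avg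
  obtain ⟨φ, _, hφ⟩ := Finset.exists_le_of_expect_le Finset.univ_nonempty hψ
  exact ⟨φ, ψ, g φ ψ, hφ⟩

/-! ### Decoding from a list -/

/-- The word `u` is not recovered by a decoder that looks for a codeword in the list `L` which is
indistinguishable from `u` under the relation `col`. -/
def DecErr {U B : Type*} (L : Finset U) (φ : U → B) (b₀ : B) (col : U → U → Prop) (u : U) : Prop :=
  u ∉ L ∨ φ u ≠ b₀ ∨ ∃ u' ∈ L, u' ≠ u ∧ φ u' = b₀ ∧ col u' u

open Classical in
/-- The decoder that looks for a codeword in the list `L` with index `i`. -/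
noncomputable def listDec {U B I : Type*} [Nonempty U] (L : Finset U) (φ : U → B) (b₀ : B)
    (β : U → I) (i : I) : U :=
  if h : ∃ u ∈ L, φ u = b₀ ∧ β u = i then h.choose else Classical.arbitrary U

/-- Outside the error event `u` is a candidate and the only one, so the unspecified choice must
return it. -/
theorem listDec_eq {U B I : Type*} [Nonempty U] {L : Finset U} {φ : U → B} {b₀ : B}
    {β : U → I} {u : U} (h : ¬DecErr L φ b₀ (fun u' u => β u' = β u) u) :
    listDec L φ b₀ β (β u) = u := by
  simp only [DecErr, not_or, not_not, not_exists, not_and] at h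
  obtain ⟨h1, h2, h3⟩ := h
  have hex : ∃ v ∈ L, φ v = b₀ ∧ β v = β u := ⟨u, h1, h2, rfl⟩
  rw [listDec, dif_pos hex]
  by_contra hne
  exact h3 _ hex.choose_spec.1 hne hex.choose_spec.2.1 hex.choose_spec.2.2

/-- Packing: the decoding error of a codeword in a random codebook of density `1/K` with random
indices that collide with probability at most `1/M`. -/
theorem expect_decErr_le {U B Ψ : Type*} [Fintype U] [DecidableEq U] [Fintype B] [Nonempty B] [Fintype Ψ]
    [Nonempty Ψ] (b₀ : B) (L : Finset U) (col : Ψ → U → U → Prop) {M Λ : ℝ} (hM : 0 < M)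
    (hL : (L.card : ℝ) ≤ Λ) (hcol : ∀ u u', u' ≠ u → (𝔼 ψ, ind (col ψ u' u)) ≤ 1 / M) (u : U) :
    (𝔼 ψ, 𝔼 φ : U → B, (Fintype.card B : ℝ) * ind (φ u = b₀) * ind (DecErr L φ b₀ (col ψ) u))
      ≤ ind (u ∉ L) + Λ / (Fintype.card B * M) := by
  classical
  set K : ℝ := (Fintype.card B : ℝ) with hK
  have hK1 : 1 ≤ K := by
    rw [hK]; exact_mod_cast Fintype.card_pos
  have hK0 : (0 : ℝ) < K := by linarith
  have step : ∀ (ψ : Ψ) (φ : U → B), K * ind (φ u = b₀) * ind (DecErr L φ b₀ (col ψ) u)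
      ≤ K * ind (φ u = b₀) * ind (u ∉ L) +
        ∑ u' ∈ L.erase u, K * (ind (col ψ u' u) * (ind (φ u = b₀) * ind (φ u' = b₀))) := by
    intro ψ φ
    by_cases h : φ u = b₀
    · have h1 : ind (DecErr L φ b₀ (col ψ) u)
          ≤ ind (u ∉ L) + ∑ u' ∈ L.erase u, ind (col ψ u' u) * ind (φ u' = b₀) := by
        have : ind (DecErr L φ b₀ (col ψ) u)
            ≤ ind (u ∉ L ∨ ∃ u' ∈ L.erase u, col ψ u' u ∧ φ u' = b₀) := by
          refine ind_mono ?_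
          rintro (h' | h' | ⟨u', h1, h2, h3, h4⟩)
          · exact Or.inl h'
          · exact absurd h h'
          · exact Or.inr ⟨u', Finset.mem_erase.2 ⟨h2, h1⟩, h4, h3⟩
        refine this.trans ((ind_or_le _ _).trans ?_)
        simp only [← ind_and]
        gcongr
        exact ind_exists_le _ _
      rw [ind_pos h]
      simp only [mul_one, one_mul]
      rw [← Finset.mul_sum, ← mul_add]
      exact mul_le_mul_of_nonneg_left h1 hK0.le
    · rw [ind_neg h]; simp
  calc (𝔼 ψ, 𝔼 φ : U → B, K * ind (φ u = b₀) * ind (DecErr L φ b₀ (col ψ) u))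
      ≤ 𝔼 ψ, 𝔼 φ : U → B, (K * ind (φ u = b₀) * ind (u ∉ L) +
        ∑ u' ∈ L.erase u, K * (ind (col ψ u' u) * (ind (φ u = b₀) * ind (φ u' = b₀)))) :=
        Finset.expect_le_expect fun ψ _ => Finset.expect_le_expect fun φ _ => step ψ φ
    -- The weight `K * ind (φ u = b₀)` has mean 1 and amounts to conditioning on `u` being a
    -- codeword. A rival in the list must be a codeword too and collide under the independent `ψ`.
    _ = K * (1 / K) * ind (u ∉ L) + ∑ u' ∈ L.erase u,
        K * ((𝔼 ψ, ind (col ψ u' u)) * ((1 / K) * (1 / K))) := by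
        simp only [Finset.expect_add_distrib, ← Finset.mul_expect, ← Finset.expect_mul,
          Finset.expect_sum_comm, Fintype.expect_const]
        rw [expect_fun_eval u (fun b => ind (b = b₀)), expect_ind_eq, ← hK]
        congr 1
        refine Finset.sum_congr rfl fun u' hu' => ?_
        rw [expect_fun_eval₂ (Finset.ne_of_mem_erase hu').symm (fun b => ind (b = b₀))
          (fun b => ind (b = b₀)), expect_ind_eq, ← hK]
    _ ≤ ind (u ∉ L) + ∑ u' ∈ L.erase u, K * ((1 / M) * ((1 / K) * (1 / K))) := by
        have : K * (1 / K) = 1 := by field_simp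
        rw [this, one_mul]
        gcongr with u' hu'
        exact hcol u u' (Finset.ne_of_mem_erase hu')
    _ ≤ ind (u ∉ L) + Λ / (K * M) := by
        rw [Finset.sum_const, nsmul_eq_mul]
        have e : K * ((1 / M) * ((1 / K) * (1 / K))) = 1 / (K * M) := by field_simp
        rw [e, mul_one_div]
        have : ((L.erase u).card : ℝ) ≤ Λ :=
          le_trans (by exact_mod_cast Finset.card_erase_le) hL
        gcongr

/-! ### Layers of random codes and the one-shot scalable code -/

/-- One layer of random coding: the codewords are chosen from a random codebook, and every decoder
`j` looks for the codeword in a list. A cost `b` of the choice is taken into account. -/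
theorem exists_layer {S T U B Ψ J : Type*} [Fintype S] [Fintype T] [Fintype U] [DecidableEq U]
    [Nonempty U] [Fintype B] [Nonempty B] [Fintype Ψ] [Nonempty Ψ] [Fintype J] (b₀ : B)
    (k : S → U → ℝ) (hk : ∀ s u, 0 ≤ k s u) (hk1 : ∀ s, ∑ u, k s u ≤ 1)
    (good : S → Finset U) {m : ℝ} (hm : ∀ s, ∀ u ∈ good s, k s u ≤ m) (hm0 : 0 ≤ m)
    (p : S → T → ℝ) (hp : ∀ s t, 0 ≤ p s t) (b : S → U → ℝ) (hb : ∀ s u, 0 ≤ b s u)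
    (a : S → ℝ) (ha : ∀ s u, b s u + Fintype.card J * ∑ t, p s t ≤ a s)
    (L : J → S → T → Finset U) (Λ M : J → ℝ) (hM : ∀ j, 0 < M j)
    (hL : ∀ j s t, ((L j s t).card : ℝ) ≤ Λ j) (col : J → Ψ → U → U → Prop)
    (hcol : ∀ j u u', u' ≠ u → (𝔼 ψ, ind (col j ψ u' u)) ≤ 1 / M j) :
    ∃ (φ : U → B) (ψ : Ψ) (g : S → U),
      ∑ s, (b s (g s) + ∑ j, ∑ t, p s t * ind (DecErr (L j s t) φ b₀ (col j ψ) (g s))) ≤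
      2 * (∑ s, ∑ u, k s u * b s u + ∑ j, ((∑ s, ∑ u, k s u * ∑ t, p s t * ind (u ∉ L j s t)) +
        Λ j / (Fintype.card B * M j) * ∑ s, ∑ t, p s t)) +
      ∑ s, a s * (16 * (((Fintype.card B : ℝ) - 1) * m) + 4 * (1 - ∑ u ∈ good s, k s u)) := by
  have hK1 : (1 : ℝ) ≤ Fintype.card B := by exact_mod_cast Fintype.card_pos
  obtain ⟨φ, ψ, g, h⟩ := exists_covering (Ψ := Ψ) b₀ k hk hk1 good hm hm0 a
    (fun φ ψ s u => b s u + ∑ j, ∑ t, p s t * ind (DecErr (L j s t) φ b₀ (col j ψ) u))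
    (fun φ ψ s u => add_nonneg (hb s u) (Finset.sum_nonneg fun j _ =>
      Finset.sum_nonneg fun t _ => mul_nonneg (hp s t) (ind_nonneg _)))
    (fun φ ψ s u => by
      refine le_trans ?_ (ha s u)
      gcongr
      rw [← nsmul_eq_mul, ← Finset.card_univ, ← Finset.sum_const]
      gcongr with j _ t _
      exact mul_le_of_le_one_right (hp s t) (ind_le_one _))
  refine ⟨φ, ψ, g, h.trans ?_⟩
  gcongr
  -- For a fixed word, `b` does not depend on the random maps, so the normalised weight leaves it
  -- unchanged; the rest is the packing bound for each decoder.
  have key : ∀ s u, (𝔼 ψ, 𝔼 φ : U → B, (Fintype.card B : ℝ) * ind (φ u = b₀) *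
      (b s u + ∑ j, ∑ t, p s t * ind (DecErr (L j s t) φ b₀ (col j ψ) u))) ≤
      b s u + ∑ j, (∑ t, p s t * ind (u ∉ L j s t) +
        Λ j / (Fintype.card B * M j) * ∑ t, p s t) := by
    intro s u
    have e : (𝔼 ψ, 𝔼 φ : U → B, (Fintype.card B : ℝ) * ind (φ u = b₀) *
        (b s u + ∑ j, ∑ t, p s t * ind (DecErr (L j s t) φ b₀ (col j ψ) u))) =
        (Fintype.card B : ℝ) * (1 / Fintype.card B) * b s u + ∑ j, ∑ t, p s t *
          (𝔼 ψ, 𝔼 φ : U → B, (Fintype.card B : ℝ) * ind (φ u = b₀) *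
            ind (DecErr (L j s t) φ b₀ (col j ψ) u)) := by
      have e' : ∀ (ψ : Ψ) (φ : U → B), (Fintype.card B : ℝ) * ind (φ u = b₀) *
          (b s u + ∑ j, ∑ t, p s t * ind (DecErr (L j s t) φ b₀ (col j ψ) u)) =
          (Fintype.card B : ℝ) * ind (φ u = b₀) * b s u + ∑ j, ∑ t, p s t *
            ((Fintype.card B : ℝ) * ind (φ u = b₀) *
              ind (DecErr (L j s t) φ b₀ (col j ψ) u)) := by
        intro ψ φ
        rw [mul_add, Finset.mul_sum]
        congr 1
        refine Finset.sum_congr rfl fun j _ => ?_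
        rw [Finset.mul_sum]
        exact Finset.sum_congr rfl fun t _ => by ring
      simp only [e']
      simp only [Finset.expect_add_distrib, Finset.expect_sum_comm, ← Finset.mul_expect,
        ← Finset.expect_mul, Fintype.expect_const]
      rw [expect_fun_eval u (fun b => ind (b = b₀)), expect_ind_eq]
    rw [e, mul_one_div_cancel (by positivity), one_mul]
    gcongr with j _
    rw [Finset.mul_sum, ← Finset.sum_add_distrib]
    refine Finset.sum_le_sum fun t _ => ?_
    refine (mul_le_mul_of_nonneg_left
      (expect_decErr_le b₀ (L j s t) (col j) (hM j) (hL j s t) (hcol j) u) (hp s t)).trans ?_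
    rw [mul_add, mul_comm (Λ j / _)]
  calc ∑ s, ∑ u, k s u * (𝔼 ψ, 𝔼 φ : U → B, (Fintype.card B : ℝ) * ind (φ u = b₀) *
      (b s u + ∑ j, ∑ t, p s t * ind (DecErr (L j s t) φ b₀ (col j ψ) u)))
      ≤ ∑ s, ∑ u, k s u * (b s u + ∑ j, (∑ t, p s t * ind (u ∉ L j s t) +
        Λ j / (Fintype.card B * M j) * ∑ t, p s t)) := by
        gcongr with s _ u _
        · exact hk s u
        · exact key s u
    _ = ∑ s, ∑ u, k s u * b s u + ∑ j, ((∑ s, ∑ u, k s u * ∑ t, p s t * ind (u ∉ L j s t)) +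
        ∑ s, (∑ u, k s u) * (Λ j / (Fintype.card B * M j) * ∑ t, p s t)) := by
        have e : ∀ s, ∑ u, k s u * (b s u + ∑ j, (∑ t, p s t * ind (u ∉ L j s t) +
            Λ j / (Fintype.card B * M j) * ∑ t, p s t)) =
            ∑ u, k s u * b s u + ∑ j, ((∑ u, k s u * ∑ t, p s t * ind (u ∉ L j s t)) +
              (∑ u, k s u) * (Λ j / (Fintype.card B * M j) * ∑ t, p s t)) := by
          intro s
          simp only [Finset.sum_mul, ← Finset.sum_add_distrib]
          rw [Finset.sum_comm, ← Finset.sum_add_distrib]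
          refine Finset.sum_congr rfl fun u _ => ?_
          rw [mul_add, Finset.mul_sum]
          simp only [mul_add]
        rw [Finset.sum_congr rfl fun s _ => e s, Finset.sum_add_distrib]
        congr 1
        rw [Finset.sum_comm]
        exact Finset.sum_congr rfl fun j _ => Finset.sum_add_distrib
    _ ≤ _ := by
        gcongr with j _
        rw [Finset.mul_sum]
        refine Finset.sum_le_sum fun s _ => ?_
        refine mul_le_of_le_one_left ?_ (hk1 s)
        have hs : 0 ≤ ∑ t, p s t := Finset.sum_nonneg fun t _ => hp s t
        -- `0 ≤ Λ j` is only known through the size of an actual list, which needs some `t`.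
        rcases isEmpty_or_nonempty T with hT | ⟨⟨t⟩⟩
        · simp
        · have : 0 ≤ Λ j := le_trans (Nat.cast_nonneg _) (hL j s t)
          have := hM j
          positivity

/-- The layer of the refinements `w` of the word `v`, for a decoder that knows `v`. -/
theorem exists_refinement {X V W Y : Type*} [Fintype X] [Fintype V] [Fintype W] [DecidableEq W]
    [Nonempty W] [Fintype Y] (p : X → Y → ℝ) (hp : ∀ x y, 0 ≤ p x y) (hp1 : ∑ x, ∑ y, p x y ≤ 1)
    (kv : X → V → ℝ) (hkv : ∀ x v, 0 ≤ kv x v) (hkv1 : ∀ x, ∑ v, kv x v ≤ 1)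
    (k : X → V → W → ℝ) (hk : ∀ x v w, 0 ≤ k x v w) (hk1 : ∀ x v, ∑ w, k x v w ≤ 1)
    (good : X → V → Finset W) {m η : ℝ} (hm : ∀ x v, ∀ w ∈ good x v, k x v w ≤ m) (hm0 : 0 ≤ m)
    (hη : 0 ≤ η) (L : V → Y → Finset W) (bad : X → W → Y → Prop) (K M : ℕ) [NeZero K] [NeZero M]
    (hcov : ((K : ℝ) - 1) * m ≤ η)
    (hgood : ∑ x, ∑ v, kv x v * (∑ y, p x y) * (1 - ∑ w ∈ good x v, k x v w) ≤ η)
    (hlist : ∑ x, ∑ v, kv x v * ∑ w, k x v w * ∑ y, p x y * ind (w ∉ L v y) ≤ η)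
    (hpack : ∀ v y, ((L v y).card : ℝ) ≤ η * (K * M))
    (hbad : ∑ x, ∑ v, kv x v * ∑ w, k x v w * ∑ y, p x y * ind (bad x w y) ≤ η) :
    ∃ (φ : W → Fin K) (β : W → Fin M) (g : X → V → W),
      ∑ x, ∑ v, kv x v * (∑ y, p x y * ind (bad x (g x v) y) +
        ∑ y, p x y * ind (DecErr (L v y) φ 0 (fun w' w => β w' = β w) (g x v))) ≤ 46 * η := by
  have hK : (0 : ℝ) < K := by exact_mod_cast NeZero.pos K
  have hM : (0 : ℝ) < M := by exact_mod_cast NeZero.pos M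
  have hpx : ∀ x, 0 ≤ ∑ y, p x y := fun x => Finset.sum_nonneg fun y _ => hp x y
  have hmass : ∑ s : X × V, ∑ y, kv s.1 s.2 * p s.1 y ≤ 1 := by
    rw [Fintype.sum_prod_type]
    simp only [← Finset.mul_sum, ← Finset.sum_mul]
    refine le_trans (Finset.sum_le_sum fun x _ => ?_) hp1
    exact mul_le_of_le_one_left (hpx x) (hkv1 x)
  -- The source of this layer is the pair `(x, v)`, weighted as under the test channel. One codebook
  -- serves all `v`; only the decoding list depends on `v`.
  obtain ⟨φ, β, g, h⟩ := exists_layer (S := X × V) (T := Y) (U := W) (B := Fin K)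
    (Ψ := W → Fin M) (J := Unit) 0 (fun s w => k s.1 s.2 w) (fun s w => hk _ _ _)
    (fun s => hk1 _ _) (fun s => good s.1 s.2) (fun s => hm _ _) hm0
    (fun s y => kv s.1 s.2 * p s.1 y) (fun s y => mul_nonneg (hkv _ _) (hp _ _))
    (fun s w => ∑ y, kv s.1 s.2 * p s.1 y * ind (bad s.1 w y))
    (fun s w => Finset.sum_nonneg fun y _ => mul_nonneg (mul_nonneg (hkv _ _) (hp _ _))
      (ind_nonneg _))
    -- One unit bounds the cost `bad`, one the error of the single decoder.
    (fun s => 2 * ∑ y, kv s.1 s.2 * p s.1 y)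
    (fun s w => by
      have : ∑ y, kv s.1 s.2 * p s.1 y * ind (bad s.1 w y) ≤ ∑ y, kv s.1 s.2 * p s.1 y :=
        Finset.sum_le_sum fun y _ => mul_le_of_le_one_right
          (mul_nonneg (hkv _ _) (hp _ _)) (ind_le_one _)
      simp only [Fintype.card_unit, Nat.cast_one]
      linarith)
    (fun _ s y => L s.2 y) (fun _ => η * (K * M)) (fun _ => M) (fun _ => hM)
    (fun _ s y => hpack _ _) (fun _ β w' w => β w' = β w)
    (fun _ w w' hw => by
      rw [expect_fun_collide hw.symm, Fintype.card_fin])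
  refine ⟨φ, β, fun x v => g (x, v), ?_⟩
  simp only [Fintype.sum_prod_type, Finset.univ_unique, Finset.sum_singleton,
    Fintype.card_fin] at h
  have e1 : ∑ x, ∑ v, kv x v * (∑ y, p x y * ind (bad x (g (x, v)) y) +
        ∑ y, p x y * ind (DecErr (L v y) φ 0 (fun w' w => β w' = β w) (g (x, v)))) =
      ∑ x, ∑ v, (∑ y, kv x v * p x y * ind (bad x (g (x, v)) y) +
        ∑ y, kv x v * p x y *
          ind (DecErr (L v y) φ 0 (fun w' w => β w' = β w) (g (x, v)))) := by
    refine Finset.sum_congr rfl fun x _ => Finset.sum_congr rfl fun v _ => ?_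
    rw [mul_add, Finset.mul_sum, Finset.mul_sum]
    simp only [mul_assoc]
  have e2 : ∀ q : X → V → W → Y → Prop, ∑ x, ∑ v, ∑ w, k x v w *
      ∑ y, kv x v * p x y * ind (q x v w y) =
      ∑ x, ∑ v, kv x v * ∑ w, k x v w * ∑ y, p x y * ind (q x v w y) := by
    intro q
    refine Finset.sum_congr rfl fun x _ => Finset.sum_congr rfl fun v _ => ?_
    rw [Finset.mul_sum]
    refine Finset.sum_congr rfl fun w _ => ?_
    simp only [mul_assoc, ← Finset.mul_sum]
    ring
  rw [e1]
  refine h.trans ?_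
  rw [e2 fun x v w y => bad x w y, e2 fun x v w y => w ∉ L v y]
  have e3 : η * (K * M) / (K * M) = η := by field_simp
  have e4 : ∑ x, ∑ v, ∑ y, kv x v * p x y ≤ 1 := by
    simpa only [Fintype.sum_prod_type] using hmass
  have e5 : ∑ x, ∑ v, 2 * (∑ y, kv x v * p x y) *
      (16 * (((K : ℝ) - 1) * m) + 4 * (1 - ∑ w ∈ good x v, k x v w)) =
      32 * (((K : ℝ) - 1) * m) * (∑ x, ∑ v, ∑ y, kv x v * p x y) +
      8 * ∑ x, ∑ v, kv x v * (∑ y, p x y) * (1 - ∑ w ∈ good x v, k x v w) := by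
    simp only [Finset.mul_sum (s := (Finset.univ : Finset X)),
      Finset.mul_sum (s := (Finset.univ : Finset V)), ← Finset.sum_add_distrib]
    refine Finset.sum_congr rfl fun x _ => Finset.sum_congr rfl fun v _ => ?_
    rw [← Finset.mul_sum]
    ring
  rw [e3, e5]
  have hc0 : 0 ≤ ((K : ℝ) - 1) * m := mul_nonneg
    (by have : (1 : ℝ) ≤ K := by exact_mod_cast NeZero.one_le
        linarith) hm0
  have e6 : 32 * (((K : ℝ) - 1) * m) * (∑ x, ∑ v, ∑ y, kv x v * p x y)
      ≤ 32 * (((K : ℝ) - 1) * m) := mul_le_of_le_one_right (by positivity) e4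
  have e7 : η * (∑ x, ∑ v, ∑ y, kv x v * p x y) ≤ η := mul_le_of_le_one_right hη e4
  -- `46 = 2 * 3 + 32 + 8`: twice the three mean costs (`bad`, list, packing), then the two covering
  -- terms.
  linarith

theorem expect_prod_eq {A B : Type*} [Fintype A] [Fintype B] (f : A × B → ℝ) :
    (𝔼 z, f z) = 𝔼 a, 𝔼 b, f (a, b) := by
  rw [← Finset.univ_product_univ, Finset.expect_product]

/-- Scalable source coding with side information, for one use of a source with values in finite
sets. The common word `v` is decoded from the index `e₀ x` by the first decoder, and from `e₀ x` and
`e₀' x` by the second one. Each decoder then recovers its own refinement of `v`. -/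
theorem exists_oneShot_code {X Y₁ Y₂ V W₁ W₂ : Type*} [Fintype X] [Fintype Y₁] [Fintype Y₂]
    [Fintype V] [Nonempty V] [Fintype W₁] [Nonempty W₁] [Fintype W₂] [Nonempty W₂]
    (p : X → Y₁ × Y₂ → ℝ) (hp : ∀ x y, 0 ≤ p x y) (hp1 : ∑ x, ∑ y, p x y ≤ 1)
    (kv : X → V → ℝ) (hkv : ∀ x v, 0 ≤ kv x v) (hkv1 : ∀ x, ∑ v, kv x v ≤ 1)
    (k₁ : X → V → W₁ → ℝ) (hk₁ : ∀ x v w, 0 ≤ k₁ x v w) (hk₁1 : ∀ x v, ∑ w, k₁ x v w ≤ 1)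
    (k₂ : X → V → W₂ → ℝ) (hk₂ : ∀ x v w, 0 ≤ k₂ x v w) (hk₂1 : ∀ x v, ∑ w, k₂ x v w ≤ 1)
    {η m₀ m₁ m₂ : ℝ} (hη : 0 ≤ η) (hm₀ : 0 ≤ m₀) (hm₁ : 0 ≤ m₁) (hm₂ : 0 ≤ m₂)
    (good₀ : X → Finset V) (hgood₀ : ∀ x, ∀ v ∈ good₀ x, kv x v ≤ m₀)
    (good₁ : X → V → Finset W₁) (hgood₁ : ∀ x v, ∀ w ∈ good₁ x v, k₁ x v w ≤ m₁)
    (good₂ : X → V → Finset W₂) (hgood₂ : ∀ x v, ∀ w ∈ good₂ x v, k₂ x v w ≤ m₂)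
    (L₀₁ : Y₁ → Finset V) (L₀₂ : Y₂ → Finset V)
    (L₁ : V → Y₁ → Finset W₁) (L₂ : V → Y₂ → Finset W₂)
    (bad₁ : X → W₁ → Y₁ → Prop) (bad₂ : X → W₂ → Y₂ → Prop)
    (K₀ K₁ K₂ M₀ M₀' M₁ M₂ : ℕ) [NeZero K₀] [NeZero K₁] [NeZero K₂] [NeZero M₀] [NeZero M₀']
    [NeZero M₁] [NeZero M₂]
    (hcov₀ : ((K₀ : ℝ) - 1) * m₀ ≤ η) (hcov₁ : ((K₁ : ℝ) - 1) * m₁ ≤ η)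
    (hcov₂ : ((K₂ : ℝ) - 1) * m₂ ≤ η)
    (hmiss₀ : ∑ x, (∑ y, p x y) * (1 - ∑ v ∈ good₀ x, kv x v) ≤ η)
    (hmiss₁ : ∑ x, ∑ v, kv x v * (∑ y, p x y) * (1 - ∑ w ∈ good₁ x v, k₁ x v w) ≤ η)
    (hmiss₂ : ∑ x, ∑ v, kv x v * (∑ y, p x y) * (1 - ∑ w ∈ good₂ x v, k₂ x v w) ≤ η)
    (hlist₀₁ : ∑ x, ∑ v, kv x v * ∑ y, p x y * ind (v ∉ L₀₁ y.1) ≤ η)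
    (hlist₀₂ : ∑ x, ∑ v, kv x v * ∑ y, p x y * ind (v ∉ L₀₂ y.2) ≤ η)
    (hlist₁ : ∑ x, ∑ v, kv x v * ∑ w, k₁ x v w * ∑ y, p x y * ind (w ∉ L₁ v y.1) ≤ η)
    (hlist₂ : ∑ x, ∑ v, kv x v * ∑ w, k₂ x v w * ∑ y, p x y * ind (w ∉ L₂ v y.2) ≤ η)
    (hpack₀₁ : ∀ y, ((L₀₁ y).card : ℝ) ≤ η * (K₀ * M₀))
    (hpack₀₂ : ∀ y, ((L₀₂ y).card : ℝ) ≤ η * (K₀ * (M₀ * M₀')))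
    (hpack₁ : ∀ v y, ((L₁ v y).card : ℝ) ≤ η * (K₁ * M₁))
    (hpack₂ : ∀ v y, ((L₂ v y).card : ℝ) ≤ η * (K₂ * M₂))
    (hbad₁ : ∑ x, ∑ v, kv x v * ∑ w, k₁ x v w * ∑ y, p x y * ind (bad₁ x w y.1) ≤ η)
    (hbad₂ : ∑ x, ∑ v, kv x v * ∑ w, k₂ x v w * ∑ y, p x y * ind (bad₂ x w y.2) ≤ η) :
    ∃ (e₀ : X → Fin M₀) (e₀' : X → Fin M₀') (e₁ : X → Fin M₁) (e₂ : X → Fin M₂)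
      (D₁ : Fin M₀ → Fin M₁ → Y₁ → W₁) (D₂ : Fin M₀ → Fin M₀' → Fin M₂ → Y₂ → W₂),
      ∑ x, ∑ y, p x y * ind (bad₁ x (D₁ (e₀ x) (e₁ x) y.1) y.1 ∨
        bad₂ x (D₂ (e₀ x) (e₀' x) (e₂ x) y.2) y.2) ≤ 312 * η := by
  classical
  obtain ⟨φ₁, β₁, g₁, h₁⟩ := exists_refinement p hp hp1 kv hkv hkv1 k₁ hk₁ hk₁1 good₁ hgood₁ hm₁ hη
    (fun v y => L₁ v y.1) (fun x w y => bad₁ x w y.1) K₁ M₁ hcov₁ hmiss₁ hlist₁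
    (fun v y => hpack₁ v y.1) hbad₁
  obtain ⟨φ₂, β₂, g₂, h₂⟩ := exists_refinement p hp hp1 kv hkv hkv1 k₂ hk₂ hk₂1 good₂ hgood₂ hm₂ hη
    (fun v y => L₂ v y.2) (fun x w y => bad₂ x w y.2) K₂ M₂ hcov₂ hmiss₂ hlist₂
    (fun v y => hpack₂ v y.2) hbad₂
  set C₁ : X → V → ℝ := fun x v => ∑ y, p x y * ind (bad₁ x (g₁ x v) y.1) +
    ∑ y, p x y * ind (DecErr (L₁ v y.1) φ₁ 0 (fun w' w => β₁ w' = β₁ w) (g₁ x v)) with hC₁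
  set C₂ : X → V → ℝ := fun x v => ∑ y, p x y * ind (bad₂ x (g₂ x v) y.2) +
    ∑ y, p x y * ind (DecErr (L₂ v y.2) φ₂ 0 (fun w' w => β₂ w' = β₂ w) (g₂ x v)) with hC₂
  have hind0 : ∀ (x : X) (q : Y₁ × Y₂ → Prop), 0 ≤ ∑ y, p x y * ind (q y) := fun x q =>
    Finset.sum_nonneg fun y _ => mul_nonneg (hp x y) (ind_nonneg _)
  have hind1 : ∀ (x : X) (q : Y₁ × Y₂ → Prop), ∑ y, p x y * ind (q y) ≤ ∑ y, p x y := fun x q =>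
    Finset.sum_le_sum fun y _ => mul_le_of_le_one_right (hp x y) (ind_le_one _)
  have hM₀ : (0 : ℝ) < M₀ := by exact_mod_cast NeZero.pos M₀
  have hM₀' : (0 : ℝ) < M₀' := by exact_mod_cast NeZero.pos M₀'
  have hK₀ : (0 : ℝ) < K₀ := by exact_mod_cast NeZero.pos K₀
  obtain ⟨φ₀, ψ, g, h⟩ := exists_layer (S := X) (T := Y₁ × Y₂) (U := V) (B := Fin K₀)
    (Ψ := (V → Fin M₀) × (V → Fin M₀')) (J := Bool) 0 kv hkv hkv1 good₀ hgood₀ hm₀ p hp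
    (fun x v => C₁ x v + C₂ x v)
    (fun x v => add_nonneg (add_nonneg (hind0 x _) (hind0 x _))
      (add_nonneg (hind0 x _) (hind0 x _)))
    -- Four units for the four events in `C₁ + C₂`, and one for each decoder of `v`.
    (fun x => 6 * ∑ y, p x y)
    (fun x v => by
      simp only [Fintype.card_bool, Nat.cast_ofNat, hC₁, hC₂]
      linarith [hind1 x fun y => bad₁ x (g₁ x v) y.1, hind1 x fun y => bad₂ x (g₂ x v) y.2,
        hind1 x fun y => DecErr (L₁ v y.1) φ₁ 0 (fun w' w => β₁ w' = β₁ w) (g₁ x v),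
        hind1 x fun y => DecErr (L₂ v y.2) φ₂ 0 (fun w' w => β₂ w' = β₂ w) (g₂ x v)])
    -- `true` is the first decoder, which bins by `ψ.1` alone; `false` is the second, which bins by
    -- the pair and so sees collisions with probability `1 / (M₀ * M₀')`.
    (fun j _ y => if j then L₀₁ y.1 else L₀₂ y.2)
    (fun j => if j then η * (K₀ * M₀) else η * (K₀ * (M₀ * M₀')))
    (fun j => if j then M₀ else M₀ * M₀')
    (fun j => by cases j <;> simp [hM₀, hM₀'])
    (fun j x y => by cases j <;> simp [hpack₀₁, hpack₀₂])
    (fun j ψ v' v => if j then ψ.1 v' = ψ.1 v else (ψ.1 v', ψ.2 v') = (ψ.1 v, ψ.2 v))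
    (fun j v v' hv => by
      rw [expect_prod_eq]
      cases j
      · simp only [Bool.false_eq_true, if_false, Prod.mk.injEq, ind_and, ← Finset.mul_expect,
          ← Finset.expect_mul]
        rw [expect_fun_collide hv.symm, expect_fun_collide hv.symm]
        simp only [Fintype.card_fin]
        rw [div_mul_div_comm, one_mul]
      · simp only [if_true, Fintype.expect_const]
        rw [expect_fun_collide hv.symm, Fintype.card_fin])
  simp only [Fintype.sum_bool, if_true, Bool.false_eq_true, if_false, Fintype.card_fin] at h
  refine ⟨fun x => ψ.1 (g x), fun x => ψ.2 (g x), fun x => β₁ (g₁ x (g x)),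
    fun x => β₂ (g₂ x (g x)),
    fun i₀ i₁ y => listDec (L₁ (listDec (L₀₁ y) φ₀ 0 ψ.1 i₀) y) φ₁ 0 β₁ i₁,
    fun i₀ i₀' i₂ y => listDec
      (L₂ (listDec (L₀₂ y) φ₀ 0 (fun v => (ψ.1 v, ψ.2 v)) (i₀, i₀')) y) φ₂ 0 β₂ i₂, ?_⟩
  refine le_trans ?_ (h.trans ?_)
  · refine Finset.sum_le_sum fun x _ => ?_
    simp only [hC₁, hC₂, ← Finset.sum_add_distrib, ← mul_add]
    refine Finset.sum_le_sum fun y _ => mul_le_mul_of_nonneg_left ?_ (hp x y)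
    simp only [← add_assoc]
    -- If both decoders find `g x` and then their refinements, the outputs are the chosen words, so
    -- a failure must be one of six events already counted in the cost.
    refine le_trans (ind_mono (q := (((((bad₁ x (g₁ x (g x)) y.1 ∨
      DecErr (L₁ (g x) y.1) φ₁ 0 (fun w' w => β₁ w' = β₁ w) (g₁ x (g x))) ∨
      bad₂ x (g₂ x (g x)) y.2) ∨
      DecErr (L₂ (g x) y.2) φ₂ 0 (fun w' w => β₂ w' = β₂ w) (g₂ x (g x))) ∨
      DecErr (L₀₁ y.1) φ₀ 0 (fun v' v => ψ.1 v' = ψ.1 v) (g x)) ∨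
      DecErr (L₀₂ y.2) φ₀ 0 (fun v' v => (ψ.1 v', ψ.2 v') = (ψ.1 v, ψ.2 v)) (g x))) ?_) ?_
    · intro hbad
      by_contra hcon
      simp only [not_or] at hcon
      obtain ⟨⟨⟨⟨⟨c1, c2⟩, c3⟩, c4⟩, c5⟩, c6⟩ := hcon
      have d6 := listDec_eq (β := fun v => (ψ.1 v, ψ.2 v)) c6
      rw [listDec_eq c5, d6, listDec_eq c2, listDec_eq c4] at hbad
      exact hbad.elim c1 c3
    · refine (ind_or_le _ _).trans (add_le_add ?_ le_rfl)
      refine (ind_or_le _ _).trans (add_le_add ?_ le_rfl)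
      refine (ind_or_le _ _).trans (add_le_add ?_ le_rfl)
      refine (ind_or_le _ _).trans (add_le_add ?_ le_rfl)
      exact ind_or_le _ _
  · have e0 : ∑ x, ∑ v, kv x v * (C₁ x v + C₂ x v) ≤ 92 * η := by
      simp only [mul_add, Finset.sum_add_distrib]
      simp only [hC₁, hC₂]
      simp only [mul_add, Finset.sum_add_distrib] at h₁ h₂ ⊢
      linarith
    have e1 : η * (K₀ * M₀) / (K₀ * M₀) = η := by field_simp
    have e2 : η * (K₀ * (M₀ * M₀')) / (K₀ * (M₀ * M₀')) = η := by field_simp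
    have e3 : ∑ x, 6 * (∑ y, p x y) *
        (16 * (((K₀ : ℝ) - 1) * m₀) + 4 * (1 - ∑ v ∈ good₀ x, kv x v)) =
        96 * (((K₀ : ℝ) - 1) * m₀) * (∑ x, ∑ y, p x y) +
        24 * ∑ x, (∑ y, p x y) * (1 - ∑ v ∈ good₀ x, kv x v) := by
      rw [Finset.mul_sum, Finset.mul_sum, ← Finset.sum_add_distrib]
      exact Finset.sum_congr rfl fun x _ => by ring
    have hc0 : 0 ≤ ((K₀ : ℝ) - 1) * m₀ := mul_nonneg
      (by have : (1 : ℝ) ≤ K₀ := by exact_mod_cast NeZero.one_le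
          linarith) hm₀
    have e4 : 96 * (((K₀ : ℝ) - 1) * m₀) * (∑ x, ∑ y, p x y) ≤ 96 * (((K₀ : ℝ) - 1) * m₀) :=
      mul_le_of_le_one_right (by positivity) hp1
    have e5 : η * (∑ x, ∑ y, p x y) ≤ η := mul_le_of_le_one_right hη hp1
    rw [e1, e2, e3]
    -- `312 = 2 * (92 + 4) + 96 + 24`, with `92 = 2 * 46` from the refinement layers and `4` from
    -- list and packing for two decoders.
    linarith

/-! ### Laws, conditional laws and conditional entropies -/

section Laws

variable {Ω α β γ ζ : Type*} [Fintype Ω]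

theorem law_eq_sum_ind (p : Ω → ℝ) (A : Ω → α) (a : α) :
    law p A a = ∑ ω, p ω * ind (A ω = a) := by
  unfold law ind
  exact Finset.sum_congr rfl fun ω _ => by split_ifs <;> simp

theorem law_nonneg {p : Ω → ℝ} (hp : ∀ ω, 0 ≤ p ω) (A : Ω → α) (a : α) : 0 ≤ law p A a := by
  rw [law_eq_sum_ind]
  exact Finset.sum_nonneg fun ω _ => mul_nonneg (hp ω) (ind_nonneg _)

theorem law_pos {p : Ω → ℝ} (hp : ∀ ω, 0 ≤ p ω) (A : Ω → α) {ω : Ω} (hω : 0 < p ω) :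
    0 < law p A (A ω) := by
  rw [law_eq_sum_ind]
  refine lt_of_lt_of_le (b := p ω * ind (A ω = A ω)) (by rw [ind_pos rfl]; simpa) ?_
  exact Finset.single_le_sum (f := fun ω' => p ω' * ind (A ω' = A ω))
    (fun ω' _ => mul_nonneg (hp ω') (ind_nonneg _)) (Finset.mem_univ ω)

theorem sum_law_mul [Fintype ζ] (p : Ω → ℝ) (Z : Ω → ζ) (g : ζ → ℝ) :
    ∑ z, law p Z z * g z = ∑ ω, p ω * g (Z ω) := by
  classical
  simp only [law_eq_sum_ind, Finset.sum_mul]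
  rw [Finset.sum_comm]
  refine Finset.sum_congr rfl fun ω _ => ?_
  rw [Finset.sum_eq_single (Z ω)]
  · rw [ind_pos rfl, mul_one]
  · intro z _ hz; rw [ind_neg (Ne.symm hz)]; simp
  · simp

theorem law_injective_map (p : Ω → ℝ) (Z : Ω → ζ) {F : ζ → α} (hF : Function.Injective F) (z : ζ) :
    law p (fun ω => F (Z ω)) (F z) = law p Z z := by
  simp only [law_eq_sum_ind, hF.eq_iff]

theorem sum_law_fst [Fintype α] (p : Ω → ℝ) (A : Ω → α) (B : Ω → β) (b : β) :
    ∑ a, law p (fun ω => (A ω, B ω)) (a, b) = law p B b := by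
  classical
  simp only [law_eq_sum_ind]
  rw [Finset.sum_comm]
  refine Finset.sum_congr rfl fun ω _ => ?_
  rw [← Finset.mul_sum]
  congr 1
  rw [Finset.sum_eq_single (A ω)]
  · congr 1; simp
  · intro a _ ha
    exact ind_neg fun h => ha (Prod.ext_iff.1 h).1.symm
  · simp

theorem law_pair_le {p : Ω → ℝ} (hp : ∀ ω, 0 ≤ p ω) (A : Ω → α) (B : Ω → β) (a : α) (b : β) :
    law p (fun ω => (A ω, B ω)) (a, b) ≤ law p B b := by
  simp only [law_eq_sum_ind]
  refine Finset.sum_le_sum fun ω _ => mul_le_mul_of_nonneg_left (ind_mono fun h => ?_) (hp ω)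
  exact (Prod.ext_iff.1 h).2

/-- The conditional probability `p(A = a | B = b)`, which is `0` where `p(B = b) = 0`. -/
noncomputable def condLaw (p : Ω → ℝ) (A : Ω → α) (B : Ω → β) (b : β) (a : α) : ℝ :=
  law p (fun ω => (A ω, B ω)) (a, b) / law p B b

theorem condLaw_nonneg {p : Ω → ℝ} (hp : ∀ ω, 0 ≤ p ω) (A : Ω → α) (B : Ω → β) (b : β) (a : α) :
    0 ≤ condLaw p A B b a :=
  div_nonneg (law_nonneg hp _ _) (law_nonneg hp _ _)

theorem condLaw_pos {p : Ω → ℝ} (hp : ∀ ω, 0 ≤ p ω) (A : Ω → α) (B : Ω → β) {ω : Ω}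
    (hω : 0 < p ω) : 0 < condLaw p A B (B ω) (A ω) :=
  div_pos (law_pos hp (fun ω => (A ω, B ω)) hω) (law_pos hp B hω)

theorem sum_condLaw_le_one [Fintype α] (p : Ω → ℝ) (A : Ω → α) (B : Ω → β) (b : β) :
    ∑ a, condLaw p A B b a ≤ 1 := by
  simp only [condLaw, ← Finset.sum_div, sum_law_fst]
  exact div_self_le_one _

theorem condLaw_mul_law {p : Ω → ℝ} (hp : ∀ ω, 0 ≤ p ω) (A : Ω → α) (B : Ω → β) (a : α) (b : β) :
    condLaw p A B b a * law p B b = law p (fun ω => (A ω, B ω)) (a, b) := by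
  by_cases h : law p B b = 0
  · have := law_pair_le hp A B a b
    rw [h, mul_zero]
    exact le_antisymm (law_nonneg hp _ _) (h ▸ this)
  · exact div_mul_cancel₀ _ h

/-- This is the defining identity divided by `p(b)`. Where `p(b) = 0` both sides vanish, so the zero
convention in `condLaw` is harmless. -/
theorem Markov.law_eq {p : Ω → ℝ} (hp : ∀ ω, 0 ≤ p ω) {A : Ω → α} {B : Ω → β} {C : Ω → γ}
    (h : Markov p A B C) (a : α) (b : β) (c : γ) :
    law p (fun ω => (A ω, B ω, C ω)) (a, b, c) =
      condLaw p A B b a * law p (fun ω => (B ω, C ω)) (b, c) := by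
  by_cases hb : law p B b = 0
  · have h1 : law p (fun ω => (A ω, B ω, C ω)) (a, b, c) ≤ law p (fun ω => (B ω, C ω)) (b, c) :=
      law_pair_le hp A (fun ω => (B ω, C ω)) a (b, c)
    have h2 : law p (fun ω => (B ω, C ω)) (b, c) ≤ law p B b := by
      have := law_pair_le hp C B c b
      refine le_trans (le_of_eq ?_) this
      exact law_injective_map p (fun ω => (C ω, B ω)) (F := Prod.swap)
        Prod.swap_injective (c, b)
    have h3 := law_nonneg hp (fun ω => (B ω, C ω)) (b, c)
    have h4 := law_nonneg hp (fun ω => (A ω, B ω, C ω)) (a, b, c)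
    rw [show law p (fun ω => (B ω, C ω)) (b, c) = 0 by linarith, mul_zero]
    linarith
  · rw [condLaw, div_mul_eq_mul_div, eq_div_iff hb]
    exact h a b c

/-- Sum the defining identity over the fibres of `f` and `g`; the condition `B` is untouched. -/
theorem Markov.map [Fintype α] [Fintype γ] {α' γ' : Type*} {p : Ω → ℝ} {A : Ω → α} {B : Ω → β}
    {C : Ω → γ} (h : Markov p A B C) (f : α → α') (g : γ → γ') :
    Markov p (fun ω => f (A ω)) B (fun ω => g (C ω)) := by
  classical
  intro a' b c'
  have e1 : law p (fun ω => (f (A ω), B ω, g (C ω))) (a', b, c') =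
      ∑ a, ∑ c, law p (fun ω => (A ω, B ω, C ω)) (a, b, c) * (ind (f a = a') * ind (g c = c')) := by
    simp only [law_eq_sum_ind, Finset.sum_mul]
    rw [Finset.sum_congr rfl fun a _ => Finset.sum_comm, Finset.sum_comm]
    refine Finset.sum_congr rfl fun ω _ => ?_
    rw [Finset.sum_eq_single (A ω), Finset.sum_eq_single (C ω)]
    · simp only [Prod.mk.injEq, ind_and, ind_pos]; ring
    · intro c _ hc
      simp only [Prod.mk.injEq, ind_and, ind_neg (Ne.symm hc)]; ring
    · simp
    · intro a _ ha
      simp only [Prod.mk.injEq, ind_and, ind_neg (Ne.symm ha)]; simp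
    · simp
  have e2 : law p (fun ω => (f (A ω), B ω)) (a', b) =
      ∑ a, law p (fun ω => (A ω, B ω)) (a, b) * ind (f a = a') := by
    simp only [law_eq_sum_ind, Finset.sum_mul]
    rw [Finset.sum_comm]
    refine Finset.sum_congr rfl fun ω _ => ?_
    rw [Finset.sum_eq_single (A ω)]
    · simp only [Prod.mk.injEq, ind_and, ind_pos]; ring
    · intro a _ ha
      simp only [Prod.mk.injEq, ind_and, ind_neg (Ne.symm ha)]; simp
    · simp
  have e3 : law p (fun ω => (B ω, g (C ω))) (b, c') =
      ∑ c, law p (fun ω => (B ω, C ω)) (b, c) * ind (g c = c') := by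
    simp only [law_eq_sum_ind, Finset.sum_mul]
    rw [Finset.sum_comm]
    refine Finset.sum_congr rfl fun ω _ => ?_
    rw [Finset.sum_eq_single (C ω)]
    · simp only [Prod.mk.injEq, ind_and, ind_pos]; ring
    · intro c _ hc
      simp only [Prod.mk.injEq, ind_and, ind_neg (Ne.symm hc)]; simp
    · simp
  rw [e1, e2, e3, Finset.sum_mul_sum, Finset.sum_mul]
  refine Finset.sum_congr rfl fun a _ => ?_
  rw [Finset.sum_mul]
  refine Finset.sum_congr rfl fun c _ => ?_
  have := h a b c
  linear_combination (ind (f a = a') * ind (g c = c')) * this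

/-- Weak union: a part of the first variable may be moved into the condition. -/
theorem Markov.weakUnion {α' : Type*} [Fintype α] [Fintype α'] [Fintype γ] {p : Ω → ℝ}
    (hp : ∀ ω, 0 ≤ p ω) {A : Ω → α} {A' : Ω → α'} {B : Ω → β} {C : Ω → γ}
    (h : Markov p (fun ω => (A ω, A' ω)) B C) : Markov p A (fun ω => (B ω, A' ω)) C := by
  intro a ⟨b, a'⟩ c
  have h1 := h.law_eq hp (a, a') b c
  have h2 := (h.map Prod.snd id).law_eq hp a' b c
  have h3 := condLaw_mul_law hp (fun ω => (A ω, A' ω)) B (a, a') b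
  have h4 := condLaw_mul_law hp A' B a' b
  have r1 : law p (fun ω => (A ω, (B ω, A' ω), C ω)) (a, (b, a'), c) =
      law p (fun ω => ((A ω, A' ω), B ω, C ω)) ((a, a'), b, c) :=
    law_injective_map p (fun ω => ((A ω, A' ω), B ω, C ω))
      (F := fun z => (z.1.1, (z.2.1, z.1.2), z.2.2))
      (fun z z' hz => by simp only [Prod.ext_iff] at hz ⊢; tauto) ((a, a'), b, c)
  have r2 : law p (fun ω => ((B ω, A' ω), C ω)) ((b, a'), c) =
      law p (fun ω => (A' ω, B ω, C ω)) (a', b, c) :=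
    law_injective_map p (fun ω => (A' ω, B ω, C ω)) (F := fun z => ((z.2.1, z.1), z.2.2))
      (fun z z' hz => by simp only [Prod.ext_iff] at hz ⊢; tauto) (a', b, c)
  have r3 : law p (fun ω => (A ω, (B ω, A' ω))) (a, (b, a')) =
      law p (fun ω => ((A ω, A' ω), B ω)) ((a, a'), b) :=
    law_injective_map p (fun ω => ((A ω, A' ω), B ω)) (F := fun z => (z.1.1, (z.2, z.1.2)))
      (fun z z' hz => by simp only [Prod.ext_iff] at hz ⊢; tauto) ((a, a'), b)
  have r4 : law p (fun ω => (B ω, A' ω)) (b, a') = law p (fun ω => (A' ω, B ω)) (a', b) :=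
    law_injective_map p (fun ω => (A' ω, B ω)) (F := Prod.swap) Prod.swap_injective (a', b)
  simp only [id] at h2
  rw [r1, r2, r3, r4, h1, h2, ← h3, ← h4]
  ring

/-- The conditional entropy `H(A|B)` in bits. -/
noncomputable def condEnt (p : Ω → ℝ) (A : Ω → α) (B : Ω → β) : ℝ :=
  expect p fun ω => -Real.logb 2 (condLaw p A B (B ω) (A ω))

/-- Data processing. The ratio `p(a|c) / p(a|b)` has mean at most 1 because `p(a,b,c) = p(a|b)
p(b,c)`; apply `log r ≤ r - 1` and average. -/
theorem Markov.condEnt_le [Fintype α] [Fintype β] [Fintype γ] {p : Ω → ℝ} (hp : p ∈ stdSimplex ℝ Ω)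
    {A : Ω → α} {B : Ω → β} {C : Ω → γ} (h : Markov p A B C) : condEnt p A B ≤ condEnt p A C := by
  have hp0 := hp.1
  have hlog2 : 0 < Real.log 2 := Real.log_pos one_lt_two
  have hr : ∑ ω, p ω * (condLaw p A C (C ω) (A ω) / condLaw p A B (B ω) (A ω)) ≤ 1 := by
    have e := sum_law_mul p (fun ω => (A ω, B ω, C ω))
      (fun z => condLaw p A C z.2.2 z.1 / condLaw p A B z.2.1 z.1)
    rw [← e, ← hp.2]
    calc ∑ z : α × β × γ, law p (fun ω => (A ω, B ω, C ω)) z *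
          (condLaw p A C z.2.2 z.1 / condLaw p A B z.2.1 z.1)
        ≤ ∑ z : α × β × γ, law p (fun ω => (B ω, C ω)) z.2 * condLaw p A C z.2.2 z.1 := by
          refine Finset.sum_le_sum fun ⟨a, b, c⟩ _ => ?_
          rw [h.law_eq hp0 a b c]
          have hk := condLaw_nonneg hp0 A C c a
          have hl := law_nonneg hp0 (fun ω => (B ω, C ω)) (b, c)
          by_cases hz : condLaw p A B b a = 0
          · simp only [hz, zero_mul]; positivity
          · refine le_of_eq ?_
            field_simp
      _ = ∑ bc : β × γ, law p (fun ω => (B ω, C ω)) bc * ∑ a, condLaw p A C bc.2 a := by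
          rw [Fintype.sum_prod_type, Finset.sum_comm]
          exact Finset.sum_congr rfl fun bc _ => by rw [Finset.mul_sum]
      _ ≤ ∑ bc : β × γ, law p (fun ω => (B ω, C ω)) bc * 1 := by
          gcongr with bc _
          · exact law_nonneg hp0 _ _
          · exact sum_condLaw_le_one p A C bc.2
      _ = ∑ ω, p ω := by
          rw [sum_law_mul p (fun ω => (B ω, C ω)) (fun _ => 1)]; simp
  have hpt : ∀ ω, p ω * (-Real.logb 2 (condLaw p A B (B ω) (A ω))) ≤
      p ω * (-Real.logb 2 (condLaw p A C (C ω) (A ω))) +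
        (p ω * (condLaw p A C (C ω) (A ω) / condLaw p A B (B ω) (A ω)) - p ω) / Real.log 2 := by
    intro ω
    rcases (hp0 ω).eq_or_lt with h0 | h0
    · simp [← h0]
    · have hb := condLaw_pos hp0 A B h0
      have hc := condLaw_pos hp0 A C h0
      have := Real.log_le_sub_one_of_pos (div_pos hc hb)
      rw [Real.log_div hc.ne' hb.ne'] at this
      have key : -Real.logb 2 (condLaw p A B (B ω) (A ω)) ≤
          -Real.logb 2 (condLaw p A C (C ω) (A ω)) +
          (condLaw p A C (C ω) (A ω) / condLaw p A B (B ω) (A ω) - 1) / Real.log 2 := by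
        rw [Real.logb, Real.logb, ← neg_div, ← neg_div, ← add_div]
        gcongr
        linarith
      calc _ ≤ p ω * _ := mul_le_mul_of_nonneg_left key h0.le
        _ = _ := by ring
  unfold condEnt expect
  refine (Finset.sum_le_sum fun ω _ => hpt ω).trans ?_
  rw [Finset.sum_add_distrib, ← Finset.sum_div, Finset.sum_sub_distrib, hp.2]
  have : (∑ ω, p ω * (condLaw p A C (C ω) (A ω) / condLaw p A B (B ω) (A ω)) - 1) / Real.log 2
      ≤ 0 := div_nonpos_of_nonpos_of_nonneg (by linarith) hlog2.le
  linarith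

/-- Chain rule: on the support `p(a,a'|b) = p(a|b) p(a'|b,a)`, and logarithms add. -/
theorem condEnt_pair {α' : Type*} {p : Ω → ℝ} (hp : ∀ ω, 0 ≤ p ω) (A : Ω → α) (A' : Ω → α')
    (B : Ω → β) : condEnt p (fun ω => (A ω, A' ω)) B =
      condEnt p A B + condEnt p A' (fun ω => (B ω, A ω)) := by
  unfold condEnt expect
  rw [← Finset.sum_add_distrib]
  refine Finset.sum_congr rfl fun ω _ => ?_
  rcases (hp ω).eq_or_lt with h0 | h0
  · simp [← h0]
  · have h1 := condLaw_pos hp A B h0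
    have h2 := condLaw_pos hp A' (fun ω => (B ω, A ω)) h0
    have e : condLaw p (fun ω => (A ω, A' ω)) B (B ω) (A ω, A' ω) =
        condLaw p A B (B ω) (A ω) * condLaw p A' (fun ω => (B ω, A ω)) (B ω, A ω) (A' ω) := by
      have r1 : law p (fun ω => (A' ω, B ω, A ω)) (A' ω, B ω, A ω) =
          law p (fun ω => ((A ω, A' ω), B ω)) ((A ω, A' ω), B ω) :=
        law_injective_map p (fun ω => ((A ω, A' ω), B ω)) (F := fun z => (z.1.2, z.2, z.1.1))
          (fun z z' hz => by simp only [Prod.ext_iff] at hz ⊢; tauto) ((A ω, A' ω), B ω)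
      have r2 : law p (fun ω => (B ω, A ω)) (B ω, A ω) = law p (fun ω => (A ω, B ω)) (A ω, B ω) :=
        law_injective_map p (fun ω => (A ω, B ω)) (F := Prod.swap) Prod.swap_injective (A ω, B ω)
      have h3 := law_pos hp (fun ω => (A ω, B ω)) h0
      simp only [condLaw]
      rw [r1, r2]
      field_simp
    beta_reduce
    rw [e, Real.logb_mul h1.ne' h2.ne']
    ring

/-- `I(A;Z|C) = H(Z|C) - H(Z|B)` if `Z` depends on `(A, C)` only through the function `B` of
`(A, C)`. -/
theorem condMI_eq_sub [Fintype α] [Fintype ζ] [Fintype γ] {p : Ω → ℝ} (hp : ∀ ω, 0 ≤ p ω)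
    (A : Ω → α) (Z : Ω → ζ) (C : Ω → γ) (B : Ω → β)
    (h : ∀ ω, law p (fun ω => (A ω, Z ω, C ω)) (A ω, Z ω, C ω) =
      condLaw p Z B (B ω) (Z ω) * law p (fun ω => (A ω, C ω)) (A ω, C ω)) :
    condMI p A Z C = condEnt p Z C - condEnt p Z B := by
  have e := sum_law_mul p (fun ω => (A ω, Z ω, C ω)) (fun z =>
    Real.logb 2 ((law p (fun ω => (A ω, Z ω, C ω)) z * law p C z.2.2) /
      (law p (fun ω => (A ω, C ω)) (z.1, z.2.2) * law p (fun ω => (Z ω, C ω)) (z.2.1, z.2.2))))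
  simp only [Fintype.sum_prod_type] at e
  unfold condMI condEnt expect
  rw [e, ← Finset.sum_sub_distrib]
  refine Finset.sum_congr rfl fun ω _ => ?_
  rcases (hp ω).eq_or_lt with h0 | h0
  · simp [← h0]
  · have h1 := condLaw_pos hp Z B h0
    have h2 := condLaw_pos hp Z C h0
    have h3 := law_pos hp (fun ω => (A ω, C ω)) h0
    have h4 := law_pos hp (fun ω => (Z ω, C ω)) h0
    have h5 := law_pos hp C h0
    have e' : law p (fun ω => (A ω, Z ω, C ω)) (A ω, Z ω, C ω) * law p C (C ω) /
        (law p (fun ω => (A ω, C ω)) (A ω, C ω) * law p (fun ω => (Z ω, C ω)) (Z ω, C ω)) =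
        condLaw p Z B (B ω) (Z ω) / condLaw p Z C (C ω) (Z ω) := by
      rw [h ω]
      have : condLaw p Z C (C ω) (Z ω) = law p (fun ω => (Z ω, C ω)) (Z ω, C ω) / law p C (C ω) :=
        rfl
      rw [this]
      field_simp
    simp only at e' ⊢
    rw [e', Real.logb_div h1.ne' h2.ne']
    ring

end Laws

/-! ### Sequences of independent copies -/

section Iid

theorem ind_forall {ι : Type*} [Fintype ι] (p : ι → Prop) : ind (∀ i, p i) = ∏ i, ind (p i) := by
  by_cases h : ∀ i, p i
  · rw [ind_pos h]; exact (Finset.prod_eq_one fun i _ => ind_pos (h i)).symm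
  · obtain ⟨i, hi⟩ := not_forall.1 h
    rw [ind_neg h]; exact (Finset.prod_eq_zero (Finset.mem_univ i) (ind_neg hi)).symm

theorem iid_nonneg {Ω : Type*} {q : Ω → ℝ} (hq : ∀ ω, 0 ≤ q ω) (n : ℕ) (ω : Fin n → Ω) : 0 ≤ iid q n ω :=
  Finset.prod_nonneg fun i _ => hq (ω i)

variable {Ω α β ζ : Type*} [Fintype Ω]

theorem iid_mem_stdSimplex {q : Ω → ℝ} (hq : q ∈ stdSimplex ℝ Ω) (n : ℕ) :
    iid q n ∈ stdSimplex ℝ (Fin n → Ω) := by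
  refine ⟨iid_nonneg hq.1 n, ?_⟩
  unfold iid
  rw [← Fintype.prod_sum (fun _ : Fin n => q)]
  simp [hq.2]

theorem expect_mono {p : Ω → ℝ} (hp : ∀ ω, 0 ≤ p ω) {f g : Ω → ℝ} (h : ∀ ω, 0 < p ω → f ω ≤ g ω) :
    expect p f ≤ expect p g := by
  refine Finset.sum_le_sum fun ω _ => ?_
  rcases (hp ω).eq_or_lt with h0 | h0
  · simp [← h0]
  · exact mul_le_mul_of_nonneg_left (h ω h0) h0.le

theorem iid_law (q : Ω → ℝ) (Z : Ω → ζ) (n : ℕ) (z : Fin n → ζ) :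
    iid (law q Z) n z = law (iid q n) (fun ω i => Z (ω i)) z := by
  rw [law_eq_sum_ind]
  simp only [iid, law_eq_sum_ind]
  rw [Fintype.prod_sum]
  refine Finset.sum_congr rfl fun ω _ => ?_
  rw [Finset.prod_mul_distrib, funext_iff, ind_forall]

theorem sum_iid_law_mul [Fintype ζ] (q : Ω → ℝ) (Z : Ω → ζ) (n : ℕ) (G : (Fin n → ζ) → ℝ) :
    ∑ z, iid (law q Z) n z * G z = expect (iid q n) fun ω => G fun i => Z (ω i) := by
  simp only [iid_law]
  exact sum_law_mul _ _ _

theorem sum_fin_succ {n : ℕ} (F : (Fin (n + 1) → Ω) → ℝ) :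
    ∑ ω, F ω = ∑ a, ∑ ω : Fin n → Ω, F (Fin.cons a ω) := by
  rw [← (Fin.consEquiv fun _ => Ω).sum_comp, Fintype.sum_prod_type]
  rfl

/-- Peel off the first letter; the cross term carries the factor `expect q g = 0`. -/
theorem expect_iid_sum_sq {q : Ω → ℝ} (hq : q ∈ stdSimplex ℝ Ω) (g : Ω → ℝ)
    (hg : expect q g = 0) (n : ℕ) :
    expect (iid q n) (fun ω => (∑ i, g (ω i)) ^ 2) = n * expect q fun ω => g ω ^ 2 := by
  induction n with
  | zero => simp [expect]
  | succ n ih =>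
    have e : ∀ (a : Ω) (ω : Fin n → Ω),
        iid q (n + 1) (Fin.cons a ω) * (∑ i, g ((Fin.cons a ω : Fin (n + 1) → Ω) i)) ^ 2 =
        (q a * g a ^ 2) * iid q n ω + (2 * (q a * g a)) * (iid q n ω * ∑ i, g (ω i)) +
          q a * (iid q n ω * (∑ i, g (ω i)) ^ 2) := by
      intro a ω
      simp only [iid, Fin.prod_univ_succ, Fin.sum_univ_succ, Fin.cons_zero, Fin.cons_succ]
      ring
    have h1 := (iid_mem_stdSimplex hq n).2
    unfold expect at hg ih ⊢
    rw [sum_fin_succ]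
    simp only [e, Finset.sum_add_distrib, ← Finset.mul_sum, ← Finset.sum_mul, h1, ih, hg, hq.2]
    push_cast
    ring

/-- The weak law of large numbers. -/
theorem eventually_expect_ind_lt_abs_sum_sub {q : Ω → ℝ} (hq : q ∈ stdSimplex ℝ Ω) (f : Ω → ℝ)
    {δ η : ℝ} (hδ : 0 < δ) (hη : 0 < η) : ∀ᶠ n : ℕ in atTop,
      expect (iid q n) (fun ω => ind (n * δ < |∑ i, f (ω i) - n * expect q f|)) ≤ η := by
  set g : Ω → ℝ := fun ω => f ω - expect q f with hg
  have hg0 : expect q g = 0 := by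
    have : expect q g = expect q f - expect q f * ∑ ω, q ω := by
      simp only [expect, hg, mul_sub, Finset.sum_sub_distrib, ← Finset.sum_mul]
      ring
    rw [this, hq.2]; ring
  filter_upwards [eventually_ge_atTop 1,
    eventually_ge_atTop ⌈(expect q fun ω => g ω ^ 2) / (δ ^ 2 * η)⌉₊] with n hn1 hn2
  have hn : (0 : ℝ) < n := by exact_mod_cast hn1
  have hn2' := Nat.ceil_le.1 hn2
  have hpt : ∀ ω : Fin n → Ω, ind (n * δ < |∑ i, f (ω i) - n * expect q f|) ≤
      (∑ i, g (ω i)) ^ 2 * (1 / (n * δ) ^ 2) := by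
    intro ω
    have e : ∑ i, f (ω i) - n * expect q f = ∑ i, g (ω i) := by
      simp [hg, Finset.sum_sub_distrib]
    rw [e]
    by_cases h : n * δ < |∑ i, g (ω i)|
    · rw [ind_pos h, mul_one_div, le_div_iff₀ (by positivity), one_mul, ← sq_abs (∑ i, g (ω i))]
      gcongr
    · rw [ind_neg h]; positivity
  refine (expect_mono (iid_nonneg hq.1 n) fun ω _ => hpt ω).trans ?_
  have e : expect (iid q n) (fun ω => (∑ i, g (ω i)) ^ 2 * (1 / (n * δ) ^ 2)) =
      expect (iid q n) (fun ω => (∑ i, g (ω i)) ^ 2) * (1 / (n * δ) ^ 2) := by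
    simp only [expect, Finset.sum_mul, mul_assoc]
  rw [e, expect_iid_sum_sq hq g hg0, mul_one_div, div_le_iff₀ (by positivity)]
  rw [div_le_iff₀ (by positivity)] at hn2'
  calc (n : ℝ) * (expect q fun ω => g ω ^ 2) ≤ n * (n * (δ ^ 2 * η)) := by gcongr
    _ = η * (n * δ) ^ 2 := by ring

/-- The conditional probability of a sequence given a sequence. -/
noncomputable def seqKernel (k : β → α → ℝ) {n : ℕ} (b : Fin n → β) (a : Fin n → α) : ℝ :=
  ∏ i, k (b i) (a i)

theorem seqKernel_nonneg {k : β → α → ℝ} (hk : ∀ b a, 0 ≤ k b a) {n : ℕ} (b : Fin n → β)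
    (a : Fin n → α) : 0 ≤ seqKernel k b a :=
  Finset.prod_nonneg fun i _ => hk (b i) (a i)

theorem sum_seqKernel_le_one [Fintype α] {k : β → α → ℝ} (hk : ∀ b a, 0 ≤ k b a)
    (hk1 : ∀ b, ∑ a, k b a ≤ 1) {n : ℕ} (b : Fin n → β) : ∑ a, seqKernel k b a ≤ 1 := by
  unfold seqKernel
  rw [← Fintype.prod_sum (fun i a => k (b i) a)]
  exact Finset.prod_le_one (fun i _ => Finset.sum_nonneg fun a _ => hk (b i) a)
    fun i _ => hk1 (b i)

open Classical in
/-- The sequences of conditional probability at most `2 ^ (-r)`. -/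
noncomputable def unlikelySeqs [Fintype α] (k : β → α → ℝ) (r : ℝ) {n : ℕ} (b : Fin n → β) :
    Finset (Fin n → α) :=
  Finset.univ.filter fun a => seqKernel k b a ≤ 2 ^ (-r)

theorem mem_unlikelySeqs [Fintype α] {k : β → α → ℝ} {r : ℝ} {n : ℕ} {b : Fin n → β}
    {a : Fin n → α} : a ∈ unlikelySeqs k r b ↔ seqKernel k b a ≤ 2 ^ (-r) := by
  simp [unlikelySeqs]

open Classical in
/-- The sequences of conditional probability at least `2 ^ (-r)`. -/
noncomputable def likelySeqs [Fintype α] (k : β → α → ℝ) (r : ℝ) {n : ℕ} (b : Fin n → β) :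
    Finset (Fin n → α) :=
  Finset.univ.filter fun a => (2 : ℝ) ^ (-r) ≤ seqKernel k b a

theorem mem_likelySeqs [Fintype α] {k : β → α → ℝ} {r : ℝ} {n : ℕ} {b : Fin n → β}
    {a : Fin n → α} : a ∈ likelySeqs k r b ↔ (2 : ℝ) ^ (-r) ≤ seqKernel k b a := by
  simp [likelySeqs]

/-- Each listed word takes at least `2^(-r)` out of a total mass of at most 1. -/
theorem card_likelySeqs_le [Fintype α] {k : β → α → ℝ} (hk : ∀ b a, 0 ≤ k b a)
    (hk1 : ∀ b, ∑ a, k b a ≤ 1) (r : ℝ) {n : ℕ} (b : Fin n → β) :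
    ((likelySeqs k r b).card : ℝ) ≤ 2 ^ r := by
  have h := Finset.card_nsmul_le_sum (likelySeqs k r b)
    (fun a => seqKernel k b a) ((2 : ℝ) ^ (-r)) (fun a ha => mem_likelySeqs.1 ha)
  have h2 : ∑ a ∈ likelySeqs k r b, seqKernel k b a ≤ 1 :=
    (Finset.sum_le_sum_of_subset_of_nonneg (Finset.subset_univ _)
      fun a _ _ => seqKernel_nonneg hk b a).trans (sum_seqKernel_le_one hk hk1 b)
  rw [nsmul_eq_mul] at h
  have e : (2 : ℝ) ^ (-r) * 2 ^ r = 1 := by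
    rw [← Real.rpow_add two_pos, neg_add_cancel, Real.rpow_zero]
  calc ((likelySeqs k r b).card : ℝ)
      = (likelySeqs k r b).card * 2 ^ (-r) * 2 ^ r := by rw [mul_assoc, e, mul_one]
    _ ≤ 1 * 2 ^ r := by gcongr; exact h.trans h2
    _ = 2 ^ r := one_mul _

/-- Asymptotic equipartition for conditional probabilities. -/
theorem eventually_aep [Fintype α] {q : Ω → ℝ} (hq : q ∈ stdSimplex ℝ Ω) (A : Ω → α) (B : Ω → β)
    {δ η : ℝ} (hδ : 0 < δ) (hη : 0 < η) : ∀ᶠ n : ℕ in atTop,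
      expect (iid q n) (fun ω => ind ((fun i => A (ω i)) ∉
        unlikelySeqs (condLaw q A B) (n * (condEnt q A B - δ)) fun i => B (ω i))) ≤ η ∧
      expect (iid q n) (fun ω => ind ((fun i => A (ω i)) ∉
        likelySeqs (condLaw q A B) (n * (condEnt q A B + δ)) fun i => B (ω i))) ≤ η := by
  filter_upwards [eventually_expect_ind_lt_abs_sum_sub hq
    (fun ω => -Real.logb 2 (condLaw q A B (B ω) (A ω))) hδ hη] with n hn
  -- Restricted to the support, since `Real.logb` of a zero factor would be 0 and the identity would
  -- fail. It turns both tails into one deviation event of the law of large numbers.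
  have key : ∀ ω : Fin n → Ω, 0 < iid q n ω →
      seqKernel (condLaw q A B) (fun i => B (ω i)) (fun i => A (ω i)) =
        2 ^ (-∑ i, -Real.logb 2 (condLaw q A B (B (ω i)) (A (ω i)))) := by
    intro ω hω
    have hpos : ∀ i, 0 < condLaw q A B (B (ω i)) (A (ω i)) := by
      intro i
      refine condLaw_pos hq.1 A B ((hq.1 (ω i)).lt_of_ne' fun h0 => ?_)
      exact hω.ne' (Finset.prod_eq_zero (Finset.mem_univ i) h0)
    rw [Finset.sum_neg_distrib, neg_neg, seqKernel, ← Real.logb_prod _ _ fun i _ => (hpos i).ne',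
      Real.rpow_logb two_pos (by norm_num) (Finset.prod_pos fun i _ => hpos i)]
  constructor
  · refine (expect_mono (iid_nonneg hq.1 n) fun ω hω => ind_mono fun h => ?_).trans hn
    rw [mem_unlikelySeqs, key ω hω, not_le, Real.rpow_lt_rpow_left_iff one_lt_two] at h
    rw [lt_abs, condEnt] at *
    right
    linarith
  · refine (expect_mono (iid_nonneg hq.1 n) fun ω hω => ind_mono fun h => ?_).trans hn
    rw [mem_likelySeqs, key ω hω, not_le, Real.rpow_lt_rpow_left_iff one_lt_two] at h
    rw [lt_abs, condEnt] at *
    left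
    linarith

end Iid

/-! ### Kernel sums as expectations over independent copies of the test channel -/

section Blocks

variable {Ω X Y₁ Y₂ V W : Type*} [Fintype Ω] [Fintype X] [Fintype Y₁] [Fintype Y₂] [Fintype V]
  [Fintype W]

theorem sum_pi_prod {α β : Type*} [Fintype α] [Fintype β] {n : ℕ} (F : (Fin n → α × β) → ℝ) :
    ∑ z, F z = ∑ a : Fin n → α, ∑ b : Fin n → β, F fun i => (a i, b i) := by
  rw [← (Equiv.arrowProdEquivProdArrow (Fin n) (fun _ => α) (fun _ => β)).symm.sum_comp,
    Fintype.sum_prod_type]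
  rfl

/-- The probability of blocks `x` and `y = (y₁, y₂)` of the source with generic law `P`. -/
noncomputable def blockLaw (P : X × Y₁ × Y₂ → ℝ) {n : ℕ} (x : Fin n → X)
    (y : (Fin n → Y₁) × (Fin n → Y₂)) : ℝ :=
  iid P n fun i => (x i, y.1 i, y.2 i)

theorem sum_sum_blockLaw_mul (P : X × Y₁ × Y₂ → ℝ) {n : ℕ}
    (G : (Fin n → X) → (Fin n → Y₁) × (Fin n → Y₂) → ℝ) :
    ∑ x, ∑ y, blockLaw P x y * G x y = expect (iid P n)
      fun s => G (fun i => (s i).1) (fun i => (s i).2.1, fun i => (s i).2.2) := by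
  unfold expect
  rw [sum_pi_prod]
  simp only [sum_pi_prod, Fintype.sum_prod_type]
  rfl

/-- Letter by letter `p(v,x,y) = p(v|x) p(x,y)`. Thus the costs in the one-shot theorem are
probabilities under the test channel. -/
theorem sum_kernel_blockLaw_mul {q : Ω → ℝ} (hq : ∀ ω, 0 ≤ q ω) {v : Ω → V} {x : Ω → X}
    {y₁ : Ω → Y₁} {y₂ : Ω → Y₂} (h : Markov q v x fun ω => (y₁ ω, y₂ ω)) {n : ℕ}
    (G : (Fin n → X) → (Fin n → V) → (Fin n → Y₁) × (Fin n → Y₂) → ℝ) :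
    ∑ a, ∑ b, seqKernel (condLaw q v x) a b *
      ∑ c, blockLaw (law q fun ω => (x ω, y₁ ω, y₂ ω)) a c * G a b c =
    expect (iid q n) fun ω => G (fun i => x (ω i)) (fun i => v (ω i))
      (fun i => y₁ (ω i), fun i => y₂ (ω i)) := by
  rw [← sum_iid_law_mul q (fun ω => (v ω, x ω, y₁ ω, y₂ ω)) n fun z =>
    G (fun i => (z i).2.1) (fun i => (z i).1) (fun i => (z i).2.2.1, fun i => (z i).2.2.2)]
  rw [sum_pi_prod, Finset.sum_comm (s := (Finset.univ : Finset (Fin n → X)))]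
  refine Finset.sum_congr rfl fun b _ => ?_
  simp only [sum_pi_prod, Fintype.sum_prod_type]
  refine Finset.sum_congr rfl fun a _ => ?_
  simp only [Finset.mul_sum]
  refine Finset.sum_congr rfl fun c₁ _ => Finset.sum_congr rfl fun c₂ _ => ?_
  rw [← mul_assoc]
  congr 1
  simp only [seqKernel, blockLaw, iid, ← Finset.prod_mul_distrib]
  refine Finset.prod_congr rfl fun i _ => ?_
  exact (h.law_eq hq (b i) (a i) (c₁ i, c₂ i)).symm

/-- Weak union gives `W ↔ (X,V) ↔ (Y₁,Y₂)`, so `p(w|x,v)` splits off; then `p(v|x)` does. -/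
theorem sum_kernels_blockLaw_mul {q : Ω → ℝ} (hq : ∀ ω, 0 ≤ q ω) {w : Ω → W} {v : Ω → V}
    {x : Ω → X} {y₁ : Ω → Y₁} {y₂ : Ω → Y₂}
    (h : Markov q (fun ω => (w ω, v ω)) x fun ω => (y₁ ω, y₂ ω)) {n : ℕ}
    (G : (Fin n → X) → (Fin n → V) → (Fin n → W) → (Fin n → Y₁) × (Fin n → Y₂) → ℝ) :
    ∑ a, ∑ b, seqKernel (condLaw q v x) a b *
      ∑ d, seqKernel (condLaw q w fun ω => (x ω, v ω)) (fun i => (a i, b i)) d *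
        ∑ c, blockLaw (law q fun ω => (x ω, y₁ ω, y₂ ω)) a c * G a b d c =
    expect (iid q n) fun ω => G (fun i => x (ω i)) (fun i => v (ω i)) (fun i => w (ω i))
      (fun i => y₁ (ω i), fun i => y₂ (ω i)) := by
  rw [← sum_iid_law_mul q (fun ω => (x ω, v ω, w ω, y₁ ω, y₂ ω)) n fun z =>
    G (fun i => (z i).1) (fun i => (z i).2.1) (fun i => (z i).2.2.1)
      (fun i => (z i).2.2.2.1, fun i => (z i).2.2.2.2)]
  simp only [sum_pi_prod, Fintype.sum_prod_type]
  refine Finset.sum_congr rfl fun a _ => Finset.sum_congr rfl fun b _ => ?_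
  simp only [Finset.mul_sum]
  refine Finset.sum_congr rfl fun d _ => Finset.sum_congr rfl fun c₁ _ =>
    Finset.sum_congr rfl fun c₂ _ => ?_
  simp only [← mul_assoc]
  congr 1
  simp only [seqKernel, blockLaw, iid, ← Finset.prod_mul_distrib]
  refine Finset.prod_congr rfl fun i _ => ?_
  have h1 := (h.weakUnion hq).law_eq hq (d i) (a i, b i) (c₁ i, c₂ i)
  have h2 := (h.map Prod.snd id).law_eq hq (b i) (a i) (c₁ i, c₂ i)
  have r1 : law q (fun ω => (w ω, (x ω, v ω), y₁ ω, y₂ ω)) (d i, (a i, b i), c₁ i, c₂ i) =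
      law q (fun ω => (x ω, v ω, w ω, y₁ ω, y₂ ω)) (a i, b i, d i, c₁ i, c₂ i) :=
    law_injective_map q (fun ω => (x ω, v ω, w ω, y₁ ω, y₂ ω))
      (F := fun z => (z.2.2.1, (z.1, z.2.1), z.2.2.2))
      (fun z z' hz => by simp only [Prod.ext_iff] at hz ⊢; tauto)
      (a i, b i, d i, c₁ i, c₂ i)
  have r2 : law q (fun ω => ((x ω, v ω), y₁ ω, y₂ ω)) ((a i, b i), c₁ i, c₂ i) =
      law q (fun ω => (v ω, x ω, y₁ ω, y₂ ω)) (b i, a i, c₁ i, c₂ i) :=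
    law_injective_map q (fun ω => (v ω, x ω, y₁ ω, y₂ ω))
      (F := fun z => ((z.2.1, z.1), z.2.2))
      (fun z z' hz => by simp only [Prod.ext_iff] at hz ⊢; tauto) (b i, a i, c₁ i, c₂ i)
  simp only [id] at h2
  rw [r1, r2, h2] at h1
  rw [h1]
  ring

theorem law_mem_stdSimplex {ζ : Type*} [Fintype ζ] {q : Ω → ℝ} (hq : q ∈ stdSimplex ℝ Ω)
    (Z : Ω → ζ) : law q Z ∈ stdSimplex ℝ ζ := by
  refine ⟨law_nonneg hq.1 Z, ?_⟩
  have := sum_law_mul q Z fun _ => 1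
  simpa [hq.2] using this

theorem sum_sum_blockLaw {P : X × Y₁ × Y₂ → ℝ} (hP : P ∈ stdSimplex ℝ (X × Y₁ × Y₂)) (n : ℕ) :
    ∑ x : Fin n → X, ∑ y, blockLaw P x y = 1 := by
  have := sum_sum_blockLaw_mul P (n := n) fun _ _ => 1
  simpa [expect, (iid_mem_stdSimplex hP n).2] using this

theorem expect_ind_not {p : Ω → ℝ} (hp : p ∈ stdSimplex ℝ Ω) (s : Ω → Prop) :
    expect p (fun ω => ind (¬s ω)) = 1 - expect p fun ω => ind (s ω) := by
  simp only [expect, ind_not, mul_sub, mul_one, Finset.sum_sub_distrib, hp.2]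

theorem sum_mem_eq_sum_ind {U : Type*} [Fintype U] (s : Finset U) (k : U → ℝ) :
    ∑ u ∈ s, k u = ∑ u, k u * ind (u ∈ s) := by
  classical
  simp [ind]

/-- The mean weight that `p(v|x)` gives to the complement of a set. -/
theorem sum_miss_le {q : Ω → ℝ} (hq : q ∈ stdSimplex ℝ Ω) {v : Ω → V} {x : Ω → X}
    {y₁ : Ω → Y₁} {y₂ : Ω → Y₂} (h : Markov q v x fun ω => (y₁ ω, y₂ ω)) {n : ℕ}
    (good : (Fin n → X) → Finset (Fin n → V)) :
    ∑ a, (∑ c, blockLaw (law q fun ω => (x ω, y₁ ω, y₂ ω)) a c) *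
      (1 - ∑ b ∈ good a, seqKernel (condLaw q v x) a b) ≤
    expect (iid q n) fun ω => ind ((fun i => v (ω i)) ∉ good fun i => x (ω i)) := by
  rw [expect_ind_not (iid_mem_stdSimplex hq n),
    ← sum_kernel_blockLaw_mul hq.1 h fun a b _ => ind (b ∈ good a)]
  simp only [mul_sub, mul_one, Finset.sum_sub_distrib]
  rw [sum_sum_blockLaw (law_mem_stdSimplex hq _)]
  refine le_of_eq ?_
  congr 1
  refine Finset.sum_congr rfl fun a _ => ?_
  rw [sum_mem_eq_sum_ind (good a), Finset.mul_sum]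
  refine Finset.sum_congr rfl fun b _ => ?_
  rw [← Finset.sum_mul]
  ring

/-- The mean weight that `p(w|x,v)` gives to the complement of a set. -/
theorem sum_refinement_miss_le {q : Ω → ℝ} (hq : q ∈ stdSimplex ℝ Ω) {w : Ω → W} {v : Ω → V}
    {x : Ω → X} {y₁ : Ω → Y₁} {y₂ : Ω → Y₂}
    (h : Markov q (fun ω => (w ω, v ω)) x fun ω => (y₁ ω, y₂ ω)) {n : ℕ}
    (good : (Fin n → X) → (Fin n → V) → Finset (Fin n → W)) :
    ∑ a, ∑ b, seqKernel (condLaw q v x) a b *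
      (∑ c, blockLaw (law q fun ω => (x ω, y₁ ω, y₂ ω)) a c) *
      (1 - ∑ d ∈ good a b, seqKernel (condLaw q w fun ω => (x ω, v ω)) (fun i => (a i, b i)) d) ≤
    expect (iid q n) fun ω =>
      ind ((fun i => w (ω i)) ∉ good (fun i => x (ω i)) fun i => v (ω i)) := by
  have hs := iid_mem_stdSimplex hq n
  have e1 := sum_kernel_blockLaw_mul hq.1 (h.map Prod.snd id) (n := n) fun _ _ _ => 1
  simp only [mul_one] at e1
  rw [expect_ind_not hs, ← sum_kernels_blockLaw_mul hq.1 h fun a b d _ => ind (d ∈ good a b)]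
  simp only [mul_sub, mul_one, Finset.sum_sub_distrib]
  rw [e1]
  refine le_of_eq ?_
  congr 1
  · simp [expect, hs.2]
  · refine Finset.sum_congr rfl fun a _ => Finset.sum_congr rfl fun b _ => ?_
    rw [sum_mem_eq_sum_ind (good a b), mul_assoc, Finset.mul_sum]
    congr 1
    refine Finset.sum_congr rfl fun d _ => ?_
    rw [← Finset.sum_mul]
    ring

end Blocks

/-! ### Exponential estimates and the block code -/

theorem eventually_two_rpow_neg_le {δ η : ℝ} (hδ : 0 < δ) (hη : 0 < η) :
    ∀ᶠ n : ℕ in atTop, (2 : ℝ) ^ (-(n * δ)) ≤ η := by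
  filter_upwards [eventually_ge_atTop ⌈-Real.logb 2 η / δ⌉₊] with n hn
  have := Nat.ceil_le.1 hn
  rw [div_le_iff₀ hδ] at this
  rw [← Real.le_logb_iff_rpow_le one_lt_two hη]
  linarith

/-- The `- 1` absorbs the rounding, so the bound holds for negative `r` too. -/
theorem ceil_two_rpow_sub_one_mul_le (r s : ℝ) :
    ((⌈(2 : ℝ) ^ r⌉₊ : ℝ) - 1) * 2 ^ (-s) ≤ 2 ^ (r - s) := by
  have := Nat.ceil_lt_add_one (show (0 : ℝ) ≤ 2 ^ r by positivity)
  rw [sub_eq_add_neg r s, Real.rpow_add two_pos]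
  gcongr
  linarith

theorem two_rpow_add_le_ceil_mul (r s : ℝ) :
    (2 : ℝ) ^ (r + s) ≤ (⌈(2 : ℝ) ^ r⌉₊ : ℝ) * ⌈(2 : ℝ) ^ s⌉₊ := by
  rw [Real.rpow_add two_pos]
  gcongr <;> exact Nat.le_ceil _

theorem ceil_two_rpow_le {r : ℝ} (hr : 0 ≤ r) : (⌈(2 : ℝ) ^ r⌉₊ : ℝ) ≤ 2 * 2 ^ r := by
  have h1 := Nat.ceil_lt_add_one (show (0 : ℝ) ≤ 2 ^ r by positivity)
  have h2 := Real.one_le_rpow one_le_two hr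
  linarith

theorem eventually_expect_ind_lt_avgDist {Ω X Z : Type*} [Fintype Ω] {q : Ω → ℝ}
    (hq : q ∈ stdSimplex ℝ Ω) (d : X → Z → ℝ) (x : Ω → X) (z : Ω → Z) {δ η : ℝ}
    (hδ : 0 < δ) (hη : 0 < η) : ∀ᶠ n : ℕ in atTop,
      expect (iid q n) (fun ω => ind (expect q (fun ω => d (x ω) (z ω)) + δ <
        avgDist d (fun i => x (ω i)) fun i => z (ω i))) ≤ η := by
  filter_upwards [eventually_expect_ind_lt_abs_sum_sub hq (fun ω => d (x ω) (z ω)) hδ hη,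
    eventually_ge_atTop 1] with n hn hn1
  have hn0 : (0 : ℝ) < n := by exact_mod_cast hn1
  refine (expect_mono (iid_nonneg hq.1 n) fun ω _ => ind_mono fun h => ?_).trans hn
  rw [avgDist, one_div_mul_eq_div, lt_div_iff₀ hn0] at h
  rw [lt_abs]
  left
  linarith

/-- The number of words in a list of likely sequences, compared to the number of bins. -/
theorem card_likelySeqs_le_mul {α β : Type*} [Fintype α] {k : β → α → ℝ} (hk : ∀ b a, 0 ≤ k b a)
    (hk1 : ∀ b, ∑ a, k b a ≤ 1) {n : ℕ} {h δ η N : ℝ} (hη : (2 : ℝ) ^ (-(n * δ)) ≤ η)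
    (hN : (2 : ℝ) ^ (n * (h + 2 * δ)) ≤ N) (b : Fin n → β) :
    ((likelySeqs k (n * (h + δ)) b).card : ℝ) ≤ η * N := by
  refine (card_likelySeqs_le hk hk1 _ b).trans ?_
  have e : (2 : ℝ) ^ (n * (h + δ)) = 2 ^ (-(n * δ)) * 2 ^ (n * (h + 2 * δ)) := by
    rw [← Real.rpow_add two_pos]; congr 1; ring
  rw [e]
  have : (0 : ℝ) < 2 ^ (-(n * δ)) := by positivity
  gcongr
  linarith

/-- Block codes whose distortions exceed the means under the test channel with small probability. -/
theorem eventually_exists_blockCode {Ω X Y₁ Y₂ V W₁ W₂ X₁ X₂ : Type*} [Fintype Ω] [Fintype X]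
    [Fintype Y₁] [Fintype Y₂] [Fintype V] [Fintype W₁] [Fintype W₂] {q : Ω → ℝ}
    (hq : q ∈ stdSimplex ℝ Ω) (x : Ω → X) (y₁ : Ω → Y₁) (y₂ : Ω → Y₂) (v : Ω → V) (w₁ : Ω → W₁)
    (w₂ : Ω → W₂) (h₁ : Markov q (fun ω => (w₁ ω, v ω)) x fun ω => (y₁ ω, y₂ ω))
    (h₂ : Markov q (fun ω => (w₂ ω, v ω)) x fun ω => (y₁ ω, y₂ ω)) (d₁ : X → X₁ → ℝ)
    (d₂ : X → X₂ → ℝ) (f₁ : W₁ → Y₁ → X₁) (f₂ : W₂ → Y₂ → X₂) {δ η : ℝ} (hδ : 0 < δ)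
    (hη : 0 < η) : ∀ᶠ n : ℕ in atTop,
    ∃ (e₀ : (Fin n → X) → Fin ⌈(2 : ℝ) ^ (n * (condEnt q v y₁ - condEnt q v x + 4 * δ))⌉₊)
      (e₀' : (Fin n → X) → Fin ⌈(2 : ℝ) ^ (n * (condEnt q v y₂ - condEnt q v y₁))⌉₊)
      (e₁ : (Fin n → X) → Fin ⌈(2 : ℝ) ^ (n * (condEnt q w₁ (fun ω => (y₁ ω, v ω)) -
        condEnt q w₁ (fun ω => (x ω, v ω)) + 4 * δ))⌉₊)
      (e₂ : (Fin n → X) → Fin ⌈(2 : ℝ) ^ (n * (condEnt q w₂ (fun ω => (y₂ ω, v ω)) -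
        condEnt q w₂ (fun ω => (x ω, v ω)) + 4 * δ))⌉₊)
      (G₁ : Fin _ → Fin _ → (Fin n → Y₁) → Fin n → W₁)
      (G₂ : Fin _ → Fin _ → Fin _ → (Fin n → Y₂) → Fin n → W₂),
      ∑ a, ∑ c, blockLaw (law q fun ω => (x ω, y₁ ω, y₂ ω)) a c *
        ind (expect q (fun ω => d₁ (x ω) (f₁ (w₁ ω) (y₁ ω))) + δ <
            avgDist d₁ a (fun i => f₁ (G₁ (e₀ a) (e₁ a) c.1 i) (c.1 i)) ∨
          expect q (fun ω => d₂ (x ω) (f₂ (w₂ ω) (y₂ ω))) + δ <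
            avgDist d₂ a (fun i => f₂ (G₂ (e₀ a) (e₀' a) (e₂ a) c.2 i) (c.2 i))) ≤ 312 * η := by
  classical
  have hΩ : Nonempty Ω := by
    by_contra h
    rw [not_nonempty_iff] at h
    simpa using hq.2
  have : Nonempty V := hΩ.map v
  have : Nonempty W₁ := hΩ.map w₁
  have : Nonempty W₂ := hΩ.map w₂
  filter_upwards [eventually_aep hq v x hδ hη, eventually_aep hq v y₁ hδ hη,
    eventually_aep hq v y₂ hδ hη, eventually_aep hq w₁ (fun ω => (x ω, v ω)) hδ hη,
    eventually_aep hq w₁ (fun ω => (y₁ ω, v ω)) hδ hη,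
    eventually_aep hq w₂ (fun ω => (x ω, v ω)) hδ hη,
    eventually_aep hq w₂ (fun ω => (y₂ ω, v ω)) hδ hη, eventually_two_rpow_neg_le hδ hη,
    eventually_expect_ind_lt_avgDist hq d₁ x (fun ω => f₁ (w₁ ω) (y₁ ω)) hδ hη,
    eventually_expect_ind_lt_avgDist hq d₂ x (fun ω => f₂ (w₂ ω) (y₂ ω)) hδ hη]
    with n a0 a01 a02 a1 a1' a2 a2' hn b1 b2
  have ne : ∀ r : ℝ, NeZero ⌈(2 : ℝ) ^ r⌉₊ := fun r =>
    ⟨(Nat.ceil_pos.2 (by positivity)).ne'⟩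
  -- The codebook density stays `2δ` below the entropy exponent and typicality loses `δ`, leaving
  -- `2^(-nδ)`.
  have hcov : ∀ h : ℝ, ((⌈(2 : ℝ) ^ (n * (h - 2 * δ))⌉₊ : ℝ) - 1) * 2 ^ (-(n * (h - δ))) ≤ η := by
    intro h
    refine (ceil_two_rpow_sub_one_mul_le _ _).trans (le_trans (le_of_eq ?_) hn)
    congr 1; ring
  -- Of the `4δ`, half repays the codebook and half beats a list of size `2^(n(h' + δ))`.
  have hpack : ∀ h h' : ℝ, (2 : ℝ) ^ (n * (h' + 2 * δ)) ≤
      (⌈(2 : ℝ) ^ (n * (h - 2 * δ))⌉₊ : ℝ) * ⌈(2 : ℝ) ^ (n * (h' - h + 4 * δ))⌉₊ := by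
    intro h h'
    refine le_trans (le_of_eq ?_) (two_rpow_add_le_ceil_mul _ _)
    congr 1; ring
  have hpack' : ∀ h h' h'' : ℝ, (2 : ℝ) ^ (n * (h'' + 2 * δ)) ≤
      (⌈(2 : ℝ) ^ (n * (h - 2 * δ))⌉₊ : ℝ) *
        (⌈(2 : ℝ) ^ (n * (h' - h + 4 * δ))⌉₊ * ⌈(2 : ℝ) ^ (n * (h'' - h'))⌉₊) := by
    intro h h' h''
    rw [← mul_assoc]
    calc (2 : ℝ) ^ (n * (h'' + 2 * δ)) = 2 ^ (n * (h' + 2 * δ)) * 2 ^ (n * (h'' - h')) := by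
          rw [← Real.rpow_add two_pos]; congr 1; ring
      _ ≤ _ := mul_le_mul (hpack h h') (Nat.le_ceil _) (by positivity) (by positivity)
  have n0 : ∀ (b : X) (a : V), 0 ≤ condLaw q v x b a := condLaw_nonneg hq.1 v x
  have n1 := condLaw_nonneg hq.1 w₁ (fun ω => (x ω, v ω))
  have n2 := condLaw_nonneg hq.1 w₂ (fun ω => (x ω, v ω))
  have hv : Markov q v x fun ω => (y₁ ω, y₂ ω) := h₁.map Prod.snd id
  have hP := law_mem_stdSimplex hq fun ω => (x ω, y₁ ω, y₂ ω)
  have := exists_oneShot_code (blockLaw (law q fun ω => (x ω, y₁ ω, y₂ ω)) (n := n))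
    (fun a c => iid_nonneg hP.1 n _) (sum_sum_blockLaw hP n).le
    (seqKernel (condLaw q v x)) (seqKernel_nonneg n0)
    (sum_seqKernel_le_one n0 (sum_condLaw_le_one q v x))
    (fun a b => seqKernel (condLaw q w₁ fun ω => (x ω, v ω)) fun i => (a i, b i))
    (fun a b => seqKernel_nonneg n1 _)
    (fun a b => sum_seqKernel_le_one n1 (sum_condLaw_le_one q w₁ _) _)
    (fun a b => seqKernel (condLaw q w₂ fun ω => (x ω, v ω)) fun i => (a i, b i))
    (fun a b => seqKernel_nonneg n2 _)
    (fun a b => sum_seqKernel_le_one n2 (sum_condLaw_le_one q w₂ _) _)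
    (η := η) hη.le (by positivity) (by positivity) (by positivity)
    (unlikelySeqs (condLaw q v x) (n * (condEnt q v x - δ)))
    (fun a b hb => mem_unlikelySeqs.1 hb)
    (fun a b => unlikelySeqs (condLaw q w₁ fun ω => (x ω, v ω))
      (n * (condEnt q w₁ (fun ω => (x ω, v ω)) - δ)) fun i => (a i, b i))
    (fun a b d hd => mem_unlikelySeqs.1 hd)
    (fun a b => unlikelySeqs (condLaw q w₂ fun ω => (x ω, v ω))
      (n * (condEnt q w₂ (fun ω => (x ω, v ω)) - δ)) fun i => (a i, b i))
    (fun a b d hd => mem_unlikelySeqs.1 hd)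
    (likelySeqs (condLaw q v y₁) (n * (condEnt q v y₁ + δ)))
    (likelySeqs (condLaw q v y₂) (n * (condEnt q v y₂ + δ)))
    (fun b c => likelySeqs (condLaw q w₁ fun ω => (y₁ ω, v ω))
      (n * (condEnt q w₁ (fun ω => (y₁ ω, v ω)) + δ)) fun i => (c i, b i))
    (fun b c => likelySeqs (condLaw q w₂ fun ω => (y₂ ω, v ω))
      (n * (condEnt q w₂ (fun ω => (y₂ ω, v ω)) + δ)) fun i => (c i, b i))
    (fun a d c => expect q (fun ω => d₁ (x ω) (f₁ (w₁ ω) (y₁ ω))) + δ <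
      avgDist d₁ a (fun i => f₁ (d i) (c i)))
    (fun a d c => expect q (fun ω => d₂ (x ω) (f₂ (w₂ ω) (y₂ ω))) + δ <
      avgDist d₂ a (fun i => f₂ (d i) (c i)))
    ⌈(2 : ℝ) ^ (n * (condEnt q v x - 2 * δ))⌉₊
    ⌈(2 : ℝ) ^ (n * (condEnt q w₁ (fun ω => (x ω, v ω)) - 2 * δ))⌉₊
    ⌈(2 : ℝ) ^ (n * (condEnt q w₂ (fun ω => (x ω, v ω)) - 2 * δ))⌉₊
    ⌈(2 : ℝ) ^ (n * (condEnt q v y₁ - condEnt q v x + 4 * δ))⌉₊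
    ⌈(2 : ℝ) ^ (n * (condEnt q v y₂ - condEnt q v y₁))⌉₊
    ⌈(2 : ℝ) ^ (n * (condEnt q w₁ (fun ω => (y₁ ω, v ω)) -
        condEnt q w₁ (fun ω => (x ω, v ω)) + 4 * δ))⌉₊
    ⌈(2 : ℝ) ^ (n * (condEnt q w₂ (fun ω => (y₂ ω, v ω)) -
        condEnt q w₂ (fun ω => (x ω, v ω)) + 4 * δ))⌉₊
    (hcov _) (hcov _) (hcov _)
    ((sum_miss_le hq hv _).trans a0.1)
    ((sum_refinement_miss_le hq h₁ _).trans a1.1)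
    ((sum_refinement_miss_le hq h₂ _).trans a2.1)
    ((sum_kernel_blockLaw_mul hq.1 hv fun a b c => ind (b ∉ likelySeqs (condLaw q v y₁)
      (n * (condEnt q v y₁ + δ)) c.1)).trans_le a01.2)
    ((sum_kernel_blockLaw_mul hq.1 hv fun a b c => ind (b ∉ likelySeqs (condLaw q v y₂)
      (n * (condEnt q v y₂ + δ)) c.2)).trans_le a02.2)
    ((sum_kernels_blockLaw_mul hq.1 h₁ fun a b d c => ind (d ∉ likelySeqs
      (condLaw q w₁ fun ω => (y₁ ω, v ω)) (n * (condEnt q w₁ (fun ω => (y₁ ω, v ω)) + δ))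
      fun i => (c.1 i, b i))).trans_le a1'.2)
    ((sum_kernels_blockLaw_mul hq.1 h₂ fun a b d c => ind (d ∉ likelySeqs
      (condLaw q w₂ fun ω => (y₂ ω, v ω)) (n * (condEnt q w₂ (fun ω => (y₂ ω, v ω)) + δ))
      fun i => (c.2 i, b i))).trans_le a2'.2)
    (card_likelySeqs_le_mul (condLaw_nonneg hq.1 v y₁) (sum_condLaw_le_one q v y₁) hn (hpack _ _))
    (card_likelySeqs_le_mul (condLaw_nonneg hq.1 v y₂) (sum_condLaw_le_one q v y₂) hn
      (hpack' _ _ _))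
    (fun b c => card_likelySeqs_le_mul (condLaw_nonneg hq.1 w₁ _) (sum_condLaw_le_one q w₁ _) hn
      (hpack _ _) _)
    (fun b c => card_likelySeqs_le_mul (condLaw_nonneg hq.1 w₂ _) (sum_condLaw_le_one q w₂ _) hn
      (hpack _ _) _)
    ((sum_kernels_blockLaw_mul hq.1 h₁ fun a b d c =>
      ind (expect q (fun ω => d₁ (x ω) (f₁ (w₁ ω) (y₁ ω))) + δ <
        avgDist d₁ a (fun i => f₁ (d i) (c.1 i)))).trans_le b1)
    ((sum_kernels_blockLaw_mul hq.1 h₂ fun a b d c =>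
      ind (expect q (fun ω => d₂ (x ω) (f₂ (w₂ ω) (y₂ ω))) + δ <
        avgDist d₂ a (fun i => f₂ (d i) (c.2 i)))).trans_le b2)
  exact this


/-! ### Code exponents as mutual informations -/

/-- Both sides vanish unless the two copies of `D` agree. This makes `H(W|X,V) ≤ H(W|Y,V)` an
instance of data processing. -/
theorem Markov.pair_right {Ω α β γ ζ : Type*} [Fintype Ω] {p : Ω → ℝ} {A : Ω → α} {B : Ω → β}
    {D : Ω → ζ} {C : Ω → γ} (h : Markov p A (fun ω => (B ω, D ω)) C) :
    Markov p A (fun ω => (B ω, D ω)) fun ω => (C ω, D ω) := by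
  intro a ⟨b, d⟩ ⟨c, d'⟩
  by_cases hd : d = d'
  · subst hd
    have e1 : law p (fun ω => (A ω, (B ω, D ω), C ω, D ω)) (a, (b, d), c, d) =
        law p (fun ω => (A ω, (B ω, D ω), C ω)) (a, (b, d), c) := by
      simp only [law_eq_sum_ind, Prod.mk.injEq]
      refine Finset.sum_congr rfl fun ω _ => ?_
      congr 2
      exact propext ⟨by tauto, by tauto⟩
    have e2 : law p (fun ω => ((B ω, D ω), C ω, D ω)) ((b, d), c, d) =
        law p (fun ω => ((B ω, D ω), C ω)) ((b, d), c) := by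
      simp only [law_eq_sum_ind, Prod.mk.injEq]
      refine Finset.sum_congr rfl fun ω _ => ?_
      congr 2
      exact propext ⟨by tauto, by tauto⟩
    rw [e1, e2]
    exact h a (b, d) c
  · have e1 : law p (fun ω => (A ω, (B ω, D ω), C ω, D ω)) (a, (b, d), c, d') = 0 := by
      rw [law_eq_sum_ind]
      refine Finset.sum_eq_zero fun ω _ => ?_
      rw [ind_neg, mul_zero]
      intro hω
      simp only [Prod.mk.injEq] at hω
      exact hd (hω.2.1.2.symm.trans hω.2.2.2)
    have e2 : law p (fun ω => ((B ω, D ω), C ω, D ω)) ((b, d), c, d') = 0 := by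
      rw [law_eq_sum_ind]
      refine Finset.sum_eq_zero fun ω _ => ?_
      rw [ind_neg, mul_zero]
      intro hω
      simp only [Prod.mk.injEq] at hω
      exact hd (hω.1.2.symm.trans hω.2.2)
    rw [e1, e2, zero_mul, mul_zero]

/-- `I(X;V,W|Y) = H(V|Y) - H(V|X) + H(W|Y,V) - H(W|X,V)` for a Markov string `(V,W) ↔ X ↔ Y`. -/
theorem Markov.condMI_pair_eq {Ω X Y V W : Type*} [Fintype Ω] [Fintype X] [Fintype Y] [Fintype V]
    [Fintype W] {q : Ω → ℝ} (hq : ∀ ω, 0 ≤ q ω) {v : Ω → V} {w : Ω → W} {x : Ω → X} {y : Ω → Y}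
    (h : Markov q (fun ω => (v ω, w ω)) x y) :
    condMI q x (fun ω => (v ω, w ω)) y = (condEnt q v y - condEnt q v x) +
      (condEnt q w (fun ω => (y ω, v ω)) - condEnt q w fun ω => (x ω, v ω)) := by
  rw [condMI_eq_sub hq x (fun ω => (v ω, w ω)) y x, condEnt_pair hq, condEnt_pair hq]
  · ring
  · intro ω
    rw [← h.law_eq hq]
    exact law_injective_map q (fun ω => ((v ω, w ω), x ω, y ω)) (F := fun z => (z.2.1, z.1, z.2.2))
      (fun z z' hz => by simp only [Prod.ext_iff] at hz ⊢; tauto) ((v ω, w ω), x ω, y ω)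

/-- `I(X;W|Y,V) = H(W|Y,V) - H(W|X,V)` for a Markov string `W ↔ (X,V) ↔ Y`. -/
theorem Markov.condMI_cond_eq {Ω X Y V W : Type*} [Fintype Ω] [Fintype X] [Fintype Y] [Fintype V]
    [Fintype W] {q : Ω → ℝ} (hq : ∀ ω, 0 ≤ q ω) {v : Ω → V} {w : Ω → W} {x : Ω → X} {y : Ω → Y}
    (h : Markov q w (fun ω => (x ω, v ω)) y) :
    condMI q x w (fun ω => (y ω, v ω)) =
      condEnt q w (fun ω => (y ω, v ω)) - condEnt q w fun ω => (x ω, v ω) := by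
  refine condMI_eq_sub hq x w (fun ω => (y ω, v ω)) (fun ω => (x ω, v ω)) fun ω => ?_
  have r1 := law_injective_map q (fun ω => (w ω, (x ω, v ω), y ω))
    (F := fun z => (z.2.1.1, z.1, (z.2.2, z.2.1.2)))
    (fun z z' hz => by simp only [Prod.ext_iff] at hz ⊢; tauto) (w ω, (x ω, v ω), y ω)
  have r2 := law_injective_map q (fun ω => ((x ω, v ω), y ω))
    (F := fun z => (z.1.1, (z.2, z.1.2)))
    (fun z z' hz => by simp only [Prod.ext_iff] at hz ⊢; tauto) ((x ω, v ω), y ω)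
  simp only at r1 r2
  rw [r1, r2, h.law_eq hq]

/-! ### Rate splitting, mean distortion and conclusion -/

/-- A code whose first index carries a part of the message for the second decoder. -/
theorem exists_code_of_splitting {X Y₁ Y₂ X₁ X₂ : Type*} {n M₀ M₀' M₁ M₂ S T : ℕ}
    (hST : M₀' * M₂ ≤ S * T) (e₀ : (Fin n → X) → Fin M₀) (e₀' : (Fin n → X) → Fin M₀')
    (e₁ : (Fin n → X) → Fin M₁) (e₂ : (Fin n → X) → Fin M₂)
    (G₁ : Fin M₀ → Fin M₁ → (Fin n → Y₁) → Fin n → X₁)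
    (G₂ : Fin M₀ → Fin M₀' → Fin M₂ → (Fin n → Y₂) → Fin n → X₂) [Nonempty (Fin n → X)] :
    ∃ c : Code X Y₁ Y₂ X₁ X₂ n (M₀ * M₁ * S) T,
      (∀ x y, c.dec₁ (c.enc₁ x) y = G₁ (e₀ x) (e₁ x) y) ∧
      ∀ x y, c.dec₂ (c.enc₁ x) (c.enc₂ x) y = G₂ (e₀ x) (e₀' x) (e₂ x) y := by
  have : Nonempty (Fin M₀' × Fin M₂) :=
    ⟨(e₀' (Classical.arbitrary _), e₂ (Classical.arbitrary _))⟩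
  obtain ⟨ι⟩ : Nonempty (Fin M₀' × Fin M₂ ↪ Fin S × Fin T) :=
    Function.Embedding.nonempty_of_card_le (by simpa using hST)
  have hι := Function.leftInverse_invFun ι.injective
  set E : (Fin M₀ × Fin M₁) × Fin S ≃ Fin (M₀ * M₁ * S) :=
    (finProdFinEquiv.prodCongr (Equiv.refl _)).trans finProdFinEquiv
  refine ⟨⟨fun x => E ((e₀ x, e₁ x), (ι (e₀' x, e₂ x)).1), fun x => (ι (e₀' x, e₂ x)).2,
    fun i y => G₁ (E.symm i).1.1 (E.symm i).1.2 y,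
    fun i j y => G₂ (E.symm i).1.1 (Function.invFun ι ((E.symm i).2, j)).1
      (Function.invFun ι ((E.symm i).2, j)).2 y⟩, fun x y => ?_, fun x y => ?_⟩
  · simp only [Equiv.symm_apply_apply]
  · simp only [Equiv.symm_apply_apply, Prod.mk.eta]
    rw [hι (e₀' x, e₂ x)]

theorem avgDist_le {X Z : Type*} {d : X → Z → ℝ} {B : ℝ} (hB0 : 0 ≤ B) (hB : ∀ x z, d x z ≤ B)
    {n : ℕ} (x : Fin n → X) (z : Fin n → Z) : avgDist d x z ≤ B := by
  unfold avgDist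
  rcases n.eq_zero_or_pos with h | h
  · subst h; simpa
  · have hn : (0 : ℝ) < n := by exact_mod_cast h
    rw [one_div_mul_eq_div, div_le_iff₀ hn]
    calc ∑ i, d (x i) (z i) ≤ ∑ _i : Fin n, B := Finset.sum_le_sum fun i _ => hB _ _
      _ = B * n := by simp [mul_comm]

/-- A distortion is close to its threshold in the mean if it rarely exceeds it. -/
theorem expect_le_add_of_ind {Ω : Type*} [Fintype Ω] {p : Ω → ℝ} (hp : p ∈ stdSimplex ℝ Ω)
    {f : Ω → ℝ} {D B η : ℝ} (hD : 0 ≤ D) (hB : 0 ≤ B) (hf : ∀ ω, f ω ≤ B) (s : Ω → Prop)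
    (hs : ∀ ω, D < f ω → s ω) (hη : expect p (fun ω => ind (s ω)) ≤ η) :
    expect p f ≤ D + B * η := by
  have h1 : expect p f ≤ expect p fun ω => D + B * ind (s ω) := by
    refine expect_mono hp.1 fun ω _ => ?_
    by_cases h : D < f ω
    · rw [ind_pos (hs ω h)]; linarith [hf ω]
    · linarith [mul_nonneg hB (ind_nonneg (s ω))]
  have h2 : (expect p fun ω => D + B * ind (s ω)) = D + B * expect p fun ω => ind (s ω) := by
    simp only [expect, mul_add, Finset.sum_add_distrib, ← Finset.sum_mul, hp.2, one_mul,
      Finset.mul_sum]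
    congr 1
    exact Finset.sum_congr rfl fun ω _ => by ring
  rw [h2] at h1
  nlinarith

/-- The constant `32 = 2^5` costs `5/n` bits per letter. -/
theorem one_div_mul_logb_le {n M : ℕ} {r ε : ℝ} (hn : 0 < n) (hM : 0 < M) (hε : 5 ≤ n * ε)
    (h : (M : ℝ) ≤ 32 * 2 ^ (n * r)) : 1 / (n : ℝ) * Real.logb 2 M ≤ r + ε := by
  have hn' : (0 : ℝ) < n := by exact_mod_cast hn
  have hM' : (0 : ℝ) < M := by exact_mod_cast hM
  rw [one_div_mul_eq_div, div_le_iff₀ hn', Real.logb_le_iff_le_rpow one_lt_two hM']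
  refine h.trans ?_
  calc (32 : ℝ) * 2 ^ (n * r) = 2 ^ (5 + n * r) := by
        rw [Real.rpow_add two_pos]; norm_num
    _ ≤ 2 ^ ((r + ε) * n) := Real.rpow_le_rpow_of_exponent_le one_le_two (by linarith)

/-- The size of the first message if the second one is moved to it beyond the rate `R₂`. -/
theorem ceil_mul_ceil_mul_ceil_le {n : ℕ} {r₀ r₀' r₁ r₂ R₁ R₂ δ : ℝ} (hδ : 0 ≤ δ) (h₀ : 0 ≤ r₀)
    (h₀' : 0 ≤ r₀') (h₁ : 0 ≤ r₁) (h₂ : 0 ≤ r₂) (hR₁ : r₀ + r₁ ≤ R₁)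
    (hR₂ : r₀ + r₀' + r₁ + r₂ ≤ R₁ + R₂) :
    ((⌈(2 : ℝ) ^ (n * (r₀ + 4 * δ))⌉₊ * ⌈(2 : ℝ) ^ (n * (r₁ + 4 * δ))⌉₊ *
      ⌈(⌈(2 : ℝ) ^ (n * r₀')⌉₊ * ⌈(2 : ℝ) ^ (n * (r₂ + 4 * δ))⌉₊ : ℝ) / 2 ^ (n * R₂)⌉₊ : ℕ) : ℝ) ≤
      32 * 2 ^ (n * (R₁ + 12 * δ)) := by
  have hn : (0 : ℝ) ≤ n := n.cast_nonneg
  have c0 := ceil_two_rpow_le (r := n * (r₀ + 4 * δ)) (by positivity)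
  have c0' := ceil_two_rpow_le (r := n * r₀') (by positivity)
  have c1 := ceil_two_rpow_le (r := n * (r₁ + 4 * δ)) (by positivity)
  have c2 := ceil_two_rpow_le (r := n * (r₂ + 4 * δ)) (by positivity)
  have cS := (Nat.ceil_lt_add_one (a := (⌈(2 : ℝ) ^ (n * r₀')⌉₊ *
    ⌈(2 : ℝ) ^ (n * (r₂ + 4 * δ))⌉₊ : ℝ) / 2 ^ (n * R₂)) (by positivity)).le
  push_cast
  have hS : (⌈(⌈(2 : ℝ) ^ (n * r₀')⌉₊ * ⌈(2 : ℝ) ^ (n * (r₂ + 4 * δ))⌉₊ : ℝ) / 2 ^ (n * R₂)⌉₊ : ℝ)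
      ≤ 4 * 2 ^ (n * (r₀' + r₂ + 4 * δ - R₂)) + 1 := by
    refine cS.trans ?_
    gcongr
    rw [div_le_iff₀ (by positivity)]
    calc (⌈(2 : ℝ) ^ (n * r₀')⌉₊ : ℝ) * ⌈(2 : ℝ) ^ (n * (r₂ + 4 * δ))⌉₊
        ≤ (2 * 2 ^ (n * r₀')) * (2 * 2 ^ (n * (r₂ + 4 * δ))) := by gcongr
      _ = 4 * (2 ^ (n * r₀') * 2 ^ (n * (r₂ + 4 * δ))) := by ring
      _ = 4 * (2 ^ (n * (r₀' + r₂ + 4 * δ - R₂)) * 2 ^ (n * R₂)) := by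
          rw [← Real.rpow_add two_pos, ← Real.rpow_add two_pos]; congr 2; ring
      _ = _ := by ring
  calc (⌈(2 : ℝ) ^ (n * (r₀ + 4 * δ))⌉₊ : ℝ) * ⌈(2 : ℝ) ^ (n * (r₁ + 4 * δ))⌉₊ *
        ⌈(⌈(2 : ℝ) ^ (n * r₀')⌉₊ * ⌈(2 : ℝ) ^ (n * (r₂ + 4 * δ))⌉₊ : ℝ) / 2 ^ (n * R₂)⌉₊
      ≤ (2 * 2 ^ (n * (r₀ + 4 * δ))) * (2 * 2 ^ (n * (r₁ + 4 * δ))) *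
        (4 * 2 ^ (n * (r₀' + r₂ + 4 * δ - R₂)) + 1) := by gcongr
    _ = 16 * (2 ^ (n * (r₀ + 4 * δ)) * 2 ^ (n * (r₁ + 4 * δ)) *
          2 ^ (n * (r₀' + r₂ + 4 * δ - R₂))) +
        4 * (2 ^ (n * (r₀ + 4 * δ)) * 2 ^ (n * (r₁ + 4 * δ))) := by ring
    _ = 16 * 2 ^ (n * (r₀ + r₀' + r₁ + r₂ - R₂ + 12 * δ)) + 4 * 2 ^ (n * (r₀ + r₁ + 8 * δ)) := by
        simp only [← Real.rpow_add two_pos]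
        congr 3 <;> ring
    -- The first term, the overflow from the second message, is controlled by the sum rate; the
    -- second comes from rounding up the overflow factor and is controlled by `R₁` alone.
    _ ≤ 16 * 2 ^ (n * (R₁ + 12 * δ)) + 4 * 2 ^ (n * (R₁ + 12 * δ)) := by
        gcongr
        · exact one_le_two
        · linarith
        · exact one_le_two
        · linarith
    _ ≤ 32 * 2 ^ (n * (R₁ + 12 * δ)) := by
        have : (0 : ℝ) < 2 ^ (n * (R₁ + 12 * δ)) := by positivity
        linarith

/-- The inner region is achievable. -/
theorem innerRegion_subset_achievableRegion {X Y₁ Y₂ X₁ X₂ : Type*} [Fintype X] [Fintype Y₁] [Fintype Y₂]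
    [Fintype X₁] [Fintype X₂]
    (P : X × Y₁ × Y₂ → ℝ) (hP : P ∈ stdSimplex ℝ (X × Y₁ × Y₂))
    (d₁ : X → X₁ → ℝ) (d₂ : X → X₂ → ℝ)
    (hd₁ : ∀ x z, 0 ≤ d₁ x z) (hd₂ : ∀ x z, 0 ≤ d₂ x z) (D₁ D₂ : ℝ) :
    innerRegion P d₁ d₂ D₁ D₂ ⊆ achievableRegion P d₁ d₂ D₁ D₂ := by
  rintro ⟨R₁, R₂⟩ ⟨W₁, W₂, V, iW₁, iW₂, iV, q, hI⟩ ε hε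
  obtain ⟨f₁, hf₁⟩ := hI.dist₁
  obtain ⟨f₂, hf₂⟩ := hI.dist₂
  have hq := hI.pmf
  have hq0 := hq.1
  have hPq : (law q fun ω => (ω.2.1, ω.2.2.1, ω.2.2.2)) = P := funext hI.marginal
  have m₁ := hI.markov.1.map (fun w => (w.1, w.2.2)) id
  have m₂ := hI.markov.1.map (fun w => (w.2.1, w.2.2)) id
  have i₁ := (hI.markov.1.map (fun w => (w.2.2, w.1)) Prod.fst).condMI_pair_eq hq0
  have i₂ := (hI.markov.1.map (fun w => (w.2.2, w.2.1)) Prod.snd).condMI_pair_eq hq0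
  have i₃ := ((m₁.map id Prod.fst).weakUnion hq0).condMI_cond_eq hq0
  -- These four inequalities say that the code exponents are nonnegative, so that each rounding up
  -- costs at most a factor 2.
  have g₀ := (hI.markov.1.map (fun w => w.2.2) Prod.fst).condEnt_le hq
  have g₀' := (hI.markov.2.map (fun w => w.1.2.2) id).condEnt_le hq
  have g₁ := ((m₁.map id Prod.fst).weakUnion hq0).pair_right.condEnt_le hq
  have g₂ := ((m₂.map id Prod.snd).weakUnion hq0).pair_right.condEnt_le hq
  have hr₁ := hI.rate₁
  have hr₂ := hI.sumRate
  simp only [id] at *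
  rw [i₁] at hr₁
  rw [i₂, i₃] at hr₂
  obtain ⟨B₁, hB₁0, hB₁⟩ : ∃ B, 0 ≤ B ∧ ∀ x z, d₁ x z ≤ B :=
    ⟨∑ x, ∑ z, d₁ x z, Finset.sum_nonneg fun x _ => Finset.sum_nonneg fun z _ => hd₁ x z,
      fun x z => (Finset.single_le_sum (fun z _ => hd₁ x z) (Finset.mem_univ z)).trans
        (Finset.single_le_sum (f := fun x => ∑ z, d₁ x z)
          (fun x _ => Finset.sum_nonneg fun z _ => hd₁ x z) (Finset.mem_univ x))⟩
  obtain ⟨B₂, hB₂0, hB₂⟩ : ∃ B, 0 ≤ B ∧ ∀ x z, d₂ x z ≤ B :=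
    ⟨∑ x, ∑ z, d₂ x z, Finset.sum_nonneg fun x _ => Finset.sum_nonneg fun z _ => hd₂ x z,
      fun x z => (Finset.single_le_sum (fun z _ => hd₂ x z) (Finset.mem_univ z)).trans
        (Finset.single_le_sum (f := fun x => ∑ z, d₂ x z)
          (fun x _ => Finset.sum_nonneg fun z _ => hd₂ x z) (Finset.mem_univ x))⟩
  -- The excess `12 * δ` of the first rate is then `ε / 2`; `η` below makes rare large distortions
  -- contribute at most `ε / 2` to the mean.
  set δ : ℝ := ε / 24 with hδ
  have hδ0 : 0 < δ := by positivity
  set η : ℝ := ε / (2 * 312 * (B₁ + B₂ + 1)) with hη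
  have hη0 : 0 < η := by positivity
  have hBη : (B₁ + B₂ + 1) * (312 * η) = ε / 2 := by
    rw [hη]; field_simp
  have hX : Nonempty X := by
    by_contra h
    rw [not_nonempty_iff] at h
    simpa using hP.2
  have main := eventually_exists_blockCode hq (fun ω => ω.2.1) (fun ω => ω.2.2.1)
    (fun ω => ω.2.2.2) (fun ω => ω.1.2.2) (fun ω => ω.1.1) (fun ω => ω.1.2.1) m₁ m₂ d₁ d₂ f₁ f₂
    hδ0 hη0
  -- Beyond `10 / ε` the constant 32 costs at most `ε / 2` bits per letter.
  have ev := main.and (eventually_ge_atTop (max 1 ⌈10 / ε⌉₊))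
  obtain ⟨N, hN⟩ := eventually_atTop.1 ev
  refine ⟨N, fun n hn => ?_⟩
  obtain ⟨⟨e₀, e₀', e₁, e₂, G₁, G₂, hG⟩, hn'⟩ := hN n hn
  have hn1 : 0 < n := lt_of_lt_of_le one_pos ((le_max_left _ _).trans hn')
  have hnε : 5 ≤ n * (ε / 2) := by
    have := Nat.ceil_le.1 ((le_max_right _ _).trans hn')
    rw [div_le_iff₀ hε] at this
    linarith
  rw [hPq, sum_sum_blockLaw_mul P] at hG
  have hR₂0 : 0 ≤ R₂ := hI.nonneg₂
  -- The second message gets `2^(nR₂)` values, rounded up; the remaining factor joins the first.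
  have hST : ∀ N₀' N₂ : ℕ, N₀' * N₂ ≤ ⌈(N₀' * N₂ : ℝ) / 2 ^ (n * R₂)⌉₊ * ⌈(2 : ℝ) ^ (n * R₂)⌉₊ := by
    intro N₀' N₂
    have h1 := Nat.le_ceil ((N₀' * N₂ : ℝ) / 2 ^ (n * R₂))
    have h2 := Nat.le_ceil ((2 : ℝ) ^ (n * R₂))
    have : (N₀' * N₂ : ℝ) ≤
        ⌈(N₀' * N₂ : ℝ) / 2 ^ (n * R₂)⌉₊ * ⌈(2 : ℝ) ^ (n * R₂)⌉₊ := by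
      calc (N₀' * N₂ : ℝ) = (N₀' * N₂ : ℝ) / 2 ^ (n * R₂) * 2 ^ (n * R₂) := by
            field_simp
        _ ≤ _ := by gcongr
    exact_mod_cast this
  obtain ⟨c, hc₁, hc₂⟩ := exists_code_of_splitting (hST _ _) e₀ e₀' e₁ e₂
    (fun i j y t => f₁ (G₁ i j y t) (y t)) (fun i j k y t => f₂ (G₂ i j k y t) (y t))
  have x₀ : Fin n → X := Classical.arbitrary _
  have hpn := iid_mem_stdSimplex hP n
  have hμ : ∀ (f : _ → ℝ), (∀ ω, 0 ≤ f ω) → 0 ≤ expect q f := fun f hf =>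
    Finset.sum_nonneg fun ω _ => mul_nonneg (hq0 ω) (hf ω)
  refine ⟨_, _, c, ⟨?_, ?_⟩, ?_, ?_⟩
  · simp only [hc₁]
    have := expect_le_add_of_ind hpn
      (add_nonneg (hμ (fun ω => d₁ ω.2.1 (f₁ ω.1.1 ω.2.2.1)) fun ω => hd₁ _ _) hδ0.le) hB₁0
      (fun s => avgDist_le hB₁0 hB₁ _ _) _ (fun s hs => Or.inl hs) hG
    refine this.trans ?_
    nlinarith
  · simp only [hc₂]
    have := expect_le_add_of_ind hpn
      (add_nonneg (hμ (fun ω => d₂ ω.2.1 (f₂ ω.1.2.1 ω.2.2.2)) fun ω => hd₂ _ _) hδ0.le) hB₂0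
      (fun s => avgDist_le hB₂0 hB₂ _ _) _ (fun s hs => Or.inr hs) hG
    refine this.trans ?_
    nlinarith
  · refine (one_div_mul_logb_le hn1 (lt_of_le_of_lt (Nat.zero_le _) (c.enc₁ x₀).2) hnε
      (ceil_mul_ceil_mul_ceil_le (R₁ := R₁) hδ0.le (by linarith) (by linarith) (by linarith)
        (by linarith) (by linarith) (by linarith))).trans ?_
    linarith
  · have hc := ceil_two_rpow_le (r := n * R₂) (by positivity)
    have hpos : (0 : ℝ) < 2 ^ (n * R₂) := by positivity
    refine (one_div_mul_logb_le hn1 (lt_of_le_of_lt (Nat.zero_le _) (c.enc₂ x₀).2) hnε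
      (r := R₂) (by linarith)).trans ?_
    linarith

end SIScalable

theorem theorem1 {X Y₁ Y₂ X₁ X₂ : Type*} [Fintype X] [Fintype Y₁] [Fintype Y₂]
    [Fintype X₁] [Fintype X₂]
    (P : X × Y₁ × Y₂ → ℝ) (hP : P ∈ stdSimplex ℝ (X × Y₁ × Y₂))
    (hMarkov : SIScalable.Markov P (fun s => s.1) (fun s => s.2.1) (fun s => s.2.2))
    (d₁ : X → X₁ → ℝ) (d₂ : X → X₂ → ℝ)
    (hd₁ : ∀ x z, 0 ≤ d₁ x z) (hd₂ : ∀ x z, 0 ≤ d₂ x z) (D₁ D₂ : ℝ) :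
    SIScalable.innerRegion P d₁ d₂ D₁ D₂ ⊆ SIScalable.achievableRegion P d₁ d₂ D₁ D₂ :=
  SIScalable.innerRegion_subset_achievableRegion P hP d₁ d₂ hd₁ hd₂ D₁ D₂
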